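/- Let $\mathfrak g$ be a finite-dimensional simple complex Lie algebra with Cartan subalgebra $\mathfrak h$, and let $\langle\cdot,\cdot\rangle$ be a non-degenerate symmetric invariant bilinear form on $\mathfrak g$. Let $\mathfrak L=(\mathfrak g\otimes\mathbb C[t,t^{-1}]\oplus\mathbb C K)\rtimes \mathrm{Vir}$, where $\mathrm{Vir}$ has basis $\{d_n, C : n\in\mathbb Z\}$, be the affine-Virasoro Lie algebra with independent central elements $K$ and $C$ and brackets \[ [x\otimes t^n,y\otimes t^m]=[x,y]\otimes t^{n+m}+m\,\delta_{m,-n}\langle x,y\rangle K,\qquad [d_n,x\otimes t^m]=m\,x\otimes t^{n+m}, \] \[ [d_n,d_m]=(m-n)d_{n+m}+\delta_{m,-n}\tfrac{n^3-n}{12}\,C . \] Let $A$ be a finitely generated commutative associative unital $\mathbb C$-algebra and let $\mathfrak L(A)=\mathfrak L\otimes A$ with bracket $[X\otimes a,Y\otimes b]=[X,Y]\otimes ab$. Put $\bar{\mathfrak h}=\mathfrak h\oplus\mathbb CK\oplus\mathbb Cd_0\oplus\mathbb CC$ (with $\mathfrak h=\mathfrak h\otimes t^0$), embedded in $\mathfrak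 L(A)$ as $\bar{\mathfrak h}\otimes 1$. An $\mathfrak L(A)$-module $V$ is called integrable if (1) $V=\bigoplus_{\lambda\in\bar{\mathfrak h}^*}V_\lambda$, where $V_\lambda=\{v\in V: hv=\lambda(h)v \text{ for all } h\in\bar{\mathfrak h}\}$, and every $V_\lambda$ is finite-dimensional; and (2) for every root $\alpha$ of $\mathfrak g$ with respect to $\mathfrak h$, and all $x\in\mathfrak g_\alpha$, $n\in\mathbb Z$, $a\in A$, the element $(x\otimes t^n)\otimes a$ acts locally nilpotently on $V$. Proposition. Let $V$ be an irreducible integrable $\mathfrak L(A)$-module on which $K=K\otimes 1$ acts as zero. Then $K\otimes a$ acts as zero on $V$ for every $a\in A$. -/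

import Mathlib

open scoped TensorProduct

noncomputable section

namespace LoopAffVir

/-! ### The Virasoro algebra -/

/-- The Witt algebra over `ℂ`: the space with basis `d_n`, `n ∈ ℤ`. -/
def Witt : Type := ℤ →₀ ℂ

namespace Witt

instance : AddCommGroup Witt := inferInstanceAs (AddCommGroup (ℤ →₀ ℂ))

instance : Module ℂ Witt := inferInstanceAs (Module ℂ (ℤ →₀ ℂ))

/-- The basis `(d_n)` of the Witt algebra. -/
def basis : Module.Basis ℤ ℂ Witt := Module.Basis.ofRepr (LinearEquiv.refl ℂ (ℤ →₀ ℂ))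

@[elab_as_elim]
theorem induction {p : Witt → Prop} (x : Witt) (zero : p 0)
    (add : ∀ a b, p a → p b → p (a + b)) (smul : ∀ (c : ℂ) a, p a → p (c • a))
    (base : ∀ n, p (basis n)) : p x := by
  have hx : x ∈ Submodule.span ℂ (Set.range basis) := by simp [basis.span_eq]
  induction hx using Submodule.span_induction with
  | mem x h => obtain ⟨n, rfl⟩ := h; exact base n
  | zero => exact zero
  | add a b _ _ ha hb => exact add a b ha hb
  | smul c a _ ha => exact smul c a ha

/-- The bilinear map with `(d_n, d_m) ↦ (m - n) d_{n+m}`. -/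
def bracketMap : Witt →ₗ[ℂ] Witt →ₗ[ℂ] Witt :=
  basis.constr ℂ fun n => basis.constr ℂ fun m => ((m : ℂ) - (n : ℂ)) • basis (n + m)

theorem bracketMap_basis (n m : ℤ) :
    bracketMap (basis n) (basis m) = ((m : ℂ) - (n : ℂ)) • basis (n + m) := by
  simp [bracketMap]

theorem bracketMap_skew (x y : Witt) : bracketMap x y = -bracketMap y x := by
  have h : bracketMap = -bracketMap.flip := by
    refine basis.ext fun n => basis.ext fun m => ?_
    simp only [bracketMap_basis, LinearMap.neg_apply, LinearMap.flip_apply, add_comm m n]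
    module
  exact LinearMap.congr_fun₂ h x y

theorem bracketMap_leibniz (x y z : Witt) :
    bracketMap x (bracketMap y z) =
      bracketMap (bracketMap x y) z + bracketMap y (bracketMap x z) := by
  refine induction x ?_ (fun a b ha hb => ?_) (fun c a ha => ?_) fun n => ?_
  · simp
  · simp only [map_add, LinearMap.add_apply, ha, hb]; abel
  · simp only [map_smul, LinearMap.smul_apply, ha, smul_add]
  refine induction y ?_ (fun a b ha hb => ?_) (fun c a ha => ?_) fun m => ?_
  · simp
  · simp only [map_add, LinearMap.add_apply, ha, hb]; abel
  · simp only [map_smul, LinearMap.smul_apply, ha, smul_add]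
  refine induction z ?_ (fun a b ha hb => ?_) (fun c a ha => ?_) fun k => ?_
  · simp
  · simp only [map_add, ha, hb]; abel
  · simp only [map_smul, ha, smul_add]
  simp only [bracketMap_basis, map_smul, LinearMap.smul_apply]
  rw [show m + (n + k) = n + (m + k) by ring, show n + m + k = n + (m + k) by ring]
  push_cast
  module

theorem bracketMap_self (x : Witt) : bracketMap x x = 0 := by
  have h : (2 : ℂ) • bracketMap x x = 0 := by
    rw [two_smul]
    nth_rewrite 1 [bracketMap_skew x x]
    exact neg_add_cancel _
  exact (smul_eq_zero.mp h).resolve_left two_ne_zero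

instance : LieRing Witt where
  bracket x y := bracketMap x y
  add_lie x y z := LinearMap.map_add₂ bracketMap x y z
  lie_add x y z := map_add (bracketMap x) y z
  lie_self := bracketMap_self
  leibniz_lie := bracketMap_leibniz

instance : LieAlgebra ℂ Witt where
  lie_smul c x y := map_smul (bracketMap x) c y

theorem lie_basis (n m : ℤ) :
    ⁅basis n, basis m⁆ = ((m : ℂ) - (n : ℂ)) • basis (n + m) :=
  bracketMap_basis n m

/-- The bilinear form with `(d_n, d_m) ↦ δ_{m,-n} (n³ - n) / 12`. -/
def virForm : Witt →ₗ[ℂ] Witt →ₗ[ℂ] ℂ :=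
  basis.constr ℂ fun n => basis.constr ℂ fun m =>
    if m = -n then ((n : ℂ) ^ 3 - (n : ℂ)) / 12 else 0

theorem virForm_basis (n m : ℤ) :
    virForm (basis n) (basis m) = if m = -n then ((n : ℂ) ^ 3 - (n : ℂ)) / 12 else 0 := by
  simp [virForm]

theorem virForm_self (x : Witt) : virForm x x = 0 := by
  have h : virForm = -virForm.flip := by
    refine basis.ext fun n => basis.ext fun m => ?_
    simp only [virForm_basis, LinearMap.neg_apply, LinearMap.flip_apply]
    by_cases hm : m = -n
    · subst hm; simp; ring
    · rw [if_neg hm, if_neg (by omega), neg_zero]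
  exact self_eq_neg.mp (LinearMap.congr_fun₂ h x x)

theorem virForm_cocycle (x y z : Witt) :
    virForm x ⁅y, z⁆ = virForm ⁅x, y⁆ z + virForm y ⁅x, z⁆ := by
  refine induction x ?_ (fun a b ha hb => ?_) (fun c a ha => ?_) fun n => ?_
  · simp
  · simp only [add_lie, map_add, LinearMap.add_apply, ha, hb]; abel
  · simp only [smul_lie, map_smul, LinearMap.smul_apply, ha, smul_add]
  refine induction y ?_ (fun a b ha hb => ?_) (fun c a ha => ?_) fun m => ?_
  · simp
  · simp only [add_lie, lie_add, map_add, LinearMap.add_apply, ha, hb]; abel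
  · simp only [smul_lie, lie_smul, map_smul, LinearMap.smul_apply, ha, smul_add]
  refine induction z ?_ (fun a b ha hb => ?_) (fun c a ha => ?_) fun k => ?_
  · simp
  · simp only [lie_add, map_add, ha, hb]; abel
  · simp only [lie_smul, map_smul, ha, smul_add]
  simp only [lie_basis, map_smul, LinearMap.smul_apply, virForm_basis, smul_eq_mul]
  by_cases h : n + m + k = 0
  · obtain rfl : k = -n - m := by omega
    rw [if_pos (by ring), if_pos (by ring), if_pos (by ring)]
    push_cast
    ring
  · rw [if_neg (by omega), if_neg (by omega), if_neg (by omega)]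
    simp

end Witt

open LieModule.Cohomology in
/-- The Virasoro cocycle on the Witt algebra. -/
def virCocycle : twoCocycle ℂ Witt (TrivialLieModule ℂ Witt ℂ) where
  val :=
    { val := Witt.virForm.compr₂ (TrivialLieModule.equiv ℂ Witt ℂ).symm.toLinearMap
      property := fun x => by simp [Witt.virForm_self] }
  property := (mem_twoCocycle_iff_of_trivial ..).mpr fun x y z => by
    have := congrArg (TrivialLieModule.equiv ℂ Witt ℂ).symm (Witt.virForm_cocycle x y z)
    rw [map_add] at this
    exact this

/-- The Virasoro algebra, the central extension of the Witt algebra with basis `d_n`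
(`n ∈ ℤ`) and `C`. -/
abbrev Vir : Type := LieAlgebra.ofTwoCocycle virCocycle

/-! ### Extending derivations to central extensions -/

section CentralExtension

open LieModule.Cohomology

variable {G : Type*} [LieRing G] [LieAlgebra ℂ G] (c : twoCocycle ℂ G (TrivialLieModule ℂ G ℂ))

theorem ext_lie (f g : LieAlgebra.ofTwoCocycle c) :
    ⁅f, g⁆ = LieAlgebra.ofProd c (⁅f.carrier.1, g.carrier.1⁆, c.1.1 f.carrier.1 g.carrier.1) := by
  rw [LieAlgebra.bracket_ofTwoCocycle]
  refine congrArg _ (Prod.ext rfl ?_)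
  simp only [LieModule.IsTrivial.trivial, add_zero, sub_zero]
  rfl

/-- A derivation of `G` that leaves the cocycle invariant extends to the central extension, acting
by zero on the center. -/
def extDer (D : LieDerivation ℂ G G) (h : ∀ f g, c.1.1 (D f) g + c.1.1 f (D g) = 0) :
    LieDerivation ℂ (LieAlgebra.ofTwoCocycle c) (LieAlgebra.ofTwoCocycle c) where
  toFun f := LieAlgebra.ofProd c (D f.carrier.1, 0)
  map_add' f g := by
    rw [← LieAlgebra.of_add, Prod.mk_add_mk, add_zero, ← map_add]
    rfl
  map_smul' r f := by
    rw [RingHom.id_apply, ← LieAlgebra.of_smul, Prod.smul_mk, smul_zero, ← map_smul]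
    rfl
  leibniz' f g := by
    rw [← lie_skew g, sub_neg_eq_add]
    simp only [LinearMap.coe_mk, AddHom.coe_mk, ext_lie]
    rw [← LieAlgebra.of_add, Prod.mk_add_mk]
    refine congrArg _ (Prod.ext ?_ ?_)
    · exact (D.apply_lie_eq_add f.carrier.1 g.carrier.1)
    · exact (h f.carrier.1 g.carrier.1).symm.trans (add_comm _ _)

theorem extDer_apply (D : LieDerivation ℂ G G) (h : ∀ f g, c.1.1 (D f) g + c.1.1 f (D g) = 0)
    (f : LieAlgebra.ofTwoCocycle c) :
    extDer c D h f = LieAlgebra.ofProd c (D f.carrier.1, 0) := rfl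

/-- The projection of a central extension onto the base. -/
def extProj : LieAlgebra.ofTwoCocycle c →ₗ⁅ℂ⁆ G where
  toFun f := f.carrier.1
  map_add' _ _ := rfl
  map_smul' _ _ := rfl
  map_lie' {_ _} := rfl

/-- The extension to `LieAlgebra.ofTwoCocycle c` of an action `ρ` by cocycle-preserving
derivations. -/
def extAct {W : Type*} [LieRing W] [LieAlgebra ℂ W] (ρ : W →ₗ⁅ℂ⁆ LieDerivation ℂ G G)
    (h : ∀ w f g, c.1.1 (ρ w f) g + c.1.1 f (ρ w g) = 0) :
    W →ₗ⁅ℂ⁆ LieDerivation ℂ (LieAlgebra.ofTwoCocycle c) (LieAlgebra.ofTwoCocycle c) where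
  toFun w := extDer c (ρ w) (h w)
  map_add' v w := LieDerivation.ext fun f => by
    rw [LieDerivation.add_apply]
    simp only [extDer_apply]
    rw [← LieAlgebra.of_add, Prod.mk_add_mk, add_zero, map_add, LieDerivation.add_apply]
  map_smul' r w := LieDerivation.ext fun f => by
    rw [RingHom.id_apply, LieDerivation.smul_apply]
    simp only [extDer_apply]
    rw [← LieAlgebra.of_smul, Prod.smul_mk, smul_zero, map_smul, LieDerivation.smul_apply]
  map_lie' {v w} := LieDerivation.ext fun f => by
    rw [LieDerivation.lie_apply, eq_sub_iff_add_eq]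
    simp only [extDer_apply]
    rw [← LieAlgebra.of_add, Prod.mk_add_mk, add_zero, LieHom.map_lie, LieDerivation.lie_apply]
    exact congrArg _ (Prod.ext (sub_add_cancel _ _) rfl)

theorem extAct_apply {W : Type*} [LieRing W] [LieAlgebra ℂ W] (ρ : W →ₗ⁅ℂ⁆ LieDerivation ℂ G G)
    (h : ∀ w f g, c.1.1 (ρ w f) g + c.1.1 f (ρ w g) = 0) (w : W) (f : LieAlgebra.ofTwoCocycle c) :
    extAct c ρ h w f = LieAlgebra.ofProd c (ρ w f.carrier.1, 0) := rfl

/-- The linear section `f ↦ (f, 0)` of a central extension. -/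
def extLift : G →ₗ[ℂ] LieAlgebra.ofTwoCocycle c where
  toFun f := LieAlgebra.ofProd c (f, 0)
  map_add' f g := by rw [← LieAlgebra.of_add, Prod.mk_add_mk, add_zero]
  map_smul' r f := by rw [RingHom.id_apply, ← LieAlgebra.of_smul, Prod.smul_mk, smul_zero]

/-- The central element `(0, 1)` of a central extension. -/
def extCen : LieAlgebra.ofTwoCocycle c :=
  LieAlgebra.ofProd c (0, (TrivialLieModule.equiv ℂ G ℂ).symm 1)

theorem extLift_lie (f g : G) : ⁅extLift c f, extLift c g⁆ =
    extLift c ⁅f, g⁆ + TrivialLieModule.equiv ℂ G ℂ (c.1.1 f g) • extCen c := by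
  rw [ext_lie]
  simp only [extLift, extCen, LinearMap.coe_mk, AddHom.coe_mk]
  rw [← LieAlgebra.of_smul, ← LieAlgebra.of_add, Prod.smul_mk, smul_zero, Prod.mk_add_mk, add_zero,
    zero_add, ← map_smul, smul_eq_mul, mul_one, LinearEquiv.symm_apply_apply]
  rfl

theorem extCen_lie (f : LieAlgebra.ofTwoCocycle c) : ⁅extCen c, f⁆ = 0 := by
  rw [ext_lie]
  exact congrArg (LieAlgebra.ofProd c)
    (Prod.ext (zero_lie f.carrier.1) (LinearMap.map_zero₂ c.1.1 f.carrier.1))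

end CentralExtension

/-! ### The derived affine Lie algebra -/

section Affine

variable {𝔤 : Type*} [LieRing 𝔤] [LieAlgebra ℂ 𝔤]

section LoopDerivations

variable (𝔤) in
/-- The linear action of the Witt algebra on the loop algebra: `d_n (t^m ⊗ x) = m t^{m+n} ⊗ x`. -/
def loopAct : Witt →ₗ[ℂ] Module.End ℂ (LieAlgebra.loopAlgebra ℂ ℤ 𝔤) :=
  Witt.basis.constr ℂ fun n => LinearMap.rTensor 𝔤
    ((AddMonoidAlgebra.basis ℤ ℂ).constr ℂ fun m => AddMonoidAlgebra.single (m + n) (m : ℂ))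

theorem loopAct_basis (n m : ℤ) (x : 𝔤) :
    loopAct 𝔤 (Witt.basis n) (AddMonoidAlgebra.single m 1 ⊗ₜ x) =
      (m : ℂ) • (AddMonoidAlgebra.single (m + n) 1 ⊗ₜ x) := by
  have h : AddMonoidAlgebra.single m (1 : ℂ) = AddMonoidAlgebra.basis ℤ ℂ m := by simp
  simp only [loopAct, Module.Basis.constr_basis, LinearMap.rTensor_tmul]
  rw [h, Module.Basis.constr_basis, TensorProduct.smul_tmul', AddMonoidAlgebra.smul_single,
    smul_eq_mul, mul_one]

@[elab_as_elim]
theorem loop_induction {p : LieAlgebra.loopAlgebra ℂ ℤ 𝔤 → Prop}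
    (f : LieAlgebra.loopAlgebra ℂ ℤ 𝔤) (zero : p 0) (add : ∀ a b, p a → p b → p (a + b))
    (base : ∀ n x, p (AddMonoidAlgebra.single n 1 ⊗ₜ x)) : p f := by
  induction f using TensorProduct.induction_on with
  | zero => exact zero
  | add a b ha hb => exact add a b ha hb
  | tmul a x =>
    induction a using AddMonoidAlgebra.induction_linear with
    | zero => simpa using zero
    | add a b ha hb => rw [TensorProduct.add_tmul]; exact add _ _ ha hb
    | single n c =>
      have : AddMonoidAlgebra.single n c ⊗ₜ[ℂ] x =
          AddMonoidAlgebra.single n (1 : ℂ) ⊗ₜ[ℂ] (c • x) := by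
        rw [← TensorProduct.smul_tmul, AddMonoidAlgebra.smul_single, smul_eq_mul, mul_one]
      rw [this]
      exact base n _

theorem loop_lie_add (f g h : LieAlgebra.loopAlgebra ℂ ℤ 𝔤) : ⁅f, g + h⁆ = ⁅f, g⁆ + ⁅f, h⁆ :=
  lie_add f g h

theorem loop_add_lie (f g h : LieAlgebra.loopAlgebra ℂ ℤ 𝔤) : ⁅f + g, h⁆ = ⁅f, h⁆ + ⁅g, h⁆ :=
  add_lie f g h

theorem loop_lie_smul (c : ℂ) (f g : LieAlgebra.loopAlgebra ℂ ℤ 𝔤) : ⁅f, c • g⁆ = c • ⁅f, g⁆ :=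
  lie_smul c f g

theorem loop_smul_lie (c : ℂ) (f g : LieAlgebra.loopAlgebra ℂ ℤ 𝔤) : ⁅c • f, g⁆ = c • ⁅f, g⁆ :=
  smul_lie c f g

theorem loop_lie_zero (f : LieAlgebra.loopAlgebra ℂ ℤ 𝔤) :
    ⁅f, (0 : LieAlgebra.loopAlgebra ℂ ℤ 𝔤)⁆ = 0 :=
  lie_zero f

theorem loop_zero_lie (f : LieAlgebra.loopAlgebra ℂ ℤ 𝔤) :
    ⁅(0 : LieAlgebra.loopAlgebra ℂ ℤ 𝔤), f⁆ = 0 :=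
  zero_lie f

theorem loopAct_leibniz (w : Witt) (f g : LieAlgebra.loopAlgebra ℂ ℤ 𝔤) :
    loopAct 𝔤 w ⁅f, g⁆ = ⁅f, loopAct 𝔤 w g⁆ + ⁅loopAct 𝔤 w f, g⁆ := by
  refine Witt.induction w ?_ (fun a b ha hb => ?_) (fun c a ha => ?_) fun n => ?_
  · simp only [map_zero, LinearMap.zero_apply, loop_lie_zero, loop_zero_lie, add_zero]
  · simp only [map_add, LinearMap.add_apply, loop_lie_add, loop_add_lie, ha, hb]
    exact add_add_add_comm _ _ _ _
  · simp only [map_smul, LinearMap.smul_apply, loop_lie_smul, loop_smul_lie, ha, smul_add]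
  refine loop_induction f ?_ (fun a b ha hb => ?_) fun m x => ?_
  · simp only [map_zero, loop_zero_lie, add_zero]
  · simp only [map_add, loop_add_lie, ha, hb]
    exact add_add_add_comm _ _ _ _
  refine loop_induction g ?_ (fun a b ha hb => ?_) fun k y => ?_
  · simp only [map_zero, loop_lie_zero, add_zero]
  · simp only [map_add, loop_lie_add, ha, hb]
    exact add_add_add_comm _ _ _ _
  simp only [LieAlgebra.ExtendScalars.bracket_tmul, AddMonoidAlgebra.single_mul_single, mul_one,
    loopAct_basis, loop_lie_smul, loop_smul_lie]
  rw [show m + (k + n) = m + k + n by ring, show m + n + k = m + k + n by ring, ← add_smul]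
  push_cast
  rw [add_comm (m : ℂ)]

theorem loopAct_lie (v w : Witt) (f : LieAlgebra.loopAlgebra ℂ ℤ 𝔤) :
    loopAct 𝔤 ⁅v, w⁆ f + loopAct 𝔤 w (loopAct 𝔤 v f) = loopAct 𝔤 v (loopAct 𝔤 w f) := by
  refine Witt.induction v ?_ (fun a b ha hb => ?_) (fun c a ha => ?_) fun n => ?_
  · simp only [zero_lie, map_zero, LinearMap.zero_apply, add_zero]
  · simp only [map_add, add_lie, LinearMap.add_apply, ← ha, ← hb]
    exact add_add_add_comm _ _ _ _
  · simp only [map_smul, smul_lie, LinearMap.smul_apply, ← ha, smul_add]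
  refine Witt.induction w ?_ (fun a b ha hb => ?_) (fun c a ha => ?_) fun m => ?_
  · simp only [lie_zero, map_zero, LinearMap.zero_apply, add_zero]
  · simp only [map_add, lie_add, LinearMap.add_apply, ← ha, ← hb]
    exact add_add_add_comm _ _ _ _
  · simp only [map_smul, lie_smul, LinearMap.smul_apply, ← ha, smul_add]
  refine loop_induction f ?_ (fun a b ha hb => ?_) fun k x => ?_
  · simp only [map_zero, add_zero]
  · simp only [map_add, ← ha, ← hb]
    exact add_add_add_comm _ _ _ _
  simp only [Witt.lie_basis, map_smul, LinearMap.smul_apply, loopAct_basis, smul_smul]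
  rw [show k + m + n = k + (n + m) by ring, show k + n + m = k + (n + m) by ring, ← add_smul]
  congr 1
  push_cast
  ring

theorem residuePairing_single (Φ : LinearMap.BilinForm ℂ 𝔤) (n m : ℤ) (x y : 𝔤) :
    LieAlgebra.LoopAlgebra.residuePairing ℂ ℤ 𝔤 Φ (AddMonoidAlgebra.single n 1 ⊗ₜ x)
      (AddMonoidAlgebra.single m 1 ⊗ₜ y) = if m = -n then (m : ℂ) * Φ x y else 0 := by
  rw [LieAlgebra.LoopAlgebra.residuePairing_apply_apply,
    LieAlgebra.LoopAlgebra.toFinsupp_single_tmul, LieAlgebra.LoopAlgebra.toFinsupp_single_tmul,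
    Finsupp.sum_single_index (by simp)]
  by_cases h : m = -n
  · subst h; simp
  · rw [if_neg h, Finsupp.single_eq_of_ne (by omega)]; simp

theorem residuePairing_loopAct (Φ : LinearMap.BilinForm ℂ 𝔤) (w : Witt)
    (f g : LieAlgebra.loopAlgebra ℂ ℤ 𝔤) :
    LieAlgebra.LoopAlgebra.residuePairing ℂ ℤ 𝔤 Φ (loopAct 𝔤 w f) g +
      LieAlgebra.LoopAlgebra.residuePairing ℂ ℤ 𝔤 Φ f (loopAct 𝔤 w g) = 0 := by
  have add4 : ∀ a b c d : ℂ, a + c = 0 → b + d = 0 → a + b + (c + d) = 0 := by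
    intro a b c d h h'; linear_combination h + h'
  refine Witt.induction w ?_ (fun a b ha hb => ?_) (fun c a ha => ?_) fun n => ?_
  · simp
  · simp only [map_add, LinearMap.add_apply]; exact add4 _ _ _ _ ha hb
  · simp only [map_smul, LinearMap.smul_apply, ← smul_add, ha, smul_zero]
  refine loop_induction f ?_ (fun a b ha hb => ?_) fun m x => ?_
  · simp
  · simp only [map_add, LinearMap.add_apply]; exact add4 _ _ _ _ ha hb
  refine loop_induction g ?_ (fun a b ha hb => ?_) fun k y => ?_
  · simp
  · simp only [map_add]; exact add4 _ _ _ _ ha hb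
  simp only [loopAct_basis, map_smul, LinearMap.smul_apply, residuePairing_single, smul_eq_mul]
  by_cases h : n + m + k = 0
  · obtain rfl : k = -n - m := by omega
    rw [if_pos (by ring), if_pos (by ring)]
    push_cast
    ring
  · rw [if_neg (by omega), if_neg (by omega)]
    simp

variable (𝔤) in
/-- The action of the Witt algebra on the loop algebra by derivations. -/
def loopDer : Witt →ₗ⁅ℂ⁆ LieDerivation ℂ (LieAlgebra.loopAlgebra ℂ ℤ 𝔤)
    (LieAlgebra.loopAlgebra ℂ ℤ 𝔤) where
  toFun w :=
    { toFun := loopAct 𝔤 w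
      map_add' := map_add (loopAct 𝔤 w)
      map_smul' := map_smul (loopAct 𝔤 w)
      leibniz' := fun f g => by
        rw [← lie_skew g, sub_neg_eq_add]
        exact loopAct_leibniz w f g }
  map_add' v w := LieDerivation.ext fun f => LinearMap.congr_fun (map_add (loopAct 𝔤) v w) f
  map_smul' c w := LieDerivation.ext fun f => LinearMap.congr_fun (map_smul (loopAct 𝔤) c w) f
  map_lie' {v w} := LieDerivation.ext fun f => by
    rw [LieDerivation.lie_apply, eq_sub_iff_add_eq]
    exact loopAct_lie v w f

theorem loopDer_apply (w : Witt) (f : LieAlgebra.loopAlgebra ℂ ℤ 𝔤) :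
    loopDer 𝔤 w f = loopAct 𝔤 w f := rfl

end LoopDerivations

variable (Φ : LinearMap.BilinForm ℂ 𝔤) (hΦ : Φ.lieInvariant 𝔤) (hΦs : Φ.IsSymm)

/-- The derived affine Lie algebra `𝔤' = 𝔤 ⊗ ℂ[t, t⁻¹] ⊕ ℂ K`: the central extension of the loop
algebra by the cocycle `(x ⊗ t^n, y ⊗ t^m) ↦ m δ_{m,-n} Φ(x, y)`. -/
def Aff : Type _ :=
  LieAlgebra.ofTwoCocycle (LieAlgebra.LoopAlgebra.twoCocycleOfBilinear ℂ ℤ 𝔤 Φ hΦ hΦs)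

instance : LieRing (Aff Φ hΦ hΦs) :=
  LieAlgebra.instLieRingOfTwoCocycle (LieAlgebra.LoopAlgebra.twoCocycleOfBilinear ℂ ℤ 𝔤 Φ hΦ hΦs)

instance : LieAlgebra ℂ (Aff Φ hΦ hΦs) :=
  LieAlgebra.instOfTwoCocycle (LieAlgebra.LoopAlgebra.twoCocycleOfBilinear ℂ ℤ 𝔤 Φ hΦ hΦs)

/-- The linear inclusion of the loop algebra into `𝔤'`. -/
def affLift : LieAlgebra.loopAlgebra ℂ ℤ 𝔤 →ₗ[ℂ] Aff Φ hΦ hΦs :=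
  extLift (LieAlgebra.LoopAlgebra.twoCocycleOfBilinear ℂ ℤ 𝔤 Φ hΦ hΦs)

/-- The central element `K` of `𝔤'`. -/
def affCen : Aff Φ hΦ hΦs :=
  extCen (LieAlgebra.LoopAlgebra.twoCocycleOfBilinear ℂ ℤ 𝔤 Φ hΦ hΦs)

theorem affLift_lie (f g : LieAlgebra.loopAlgebra ℂ ℤ 𝔤) :
    ⁅affLift Φ hΦ hΦs f, affLift Φ hΦ hΦs g⁆ = affLift Φ hΦ hΦs ⁅f, g⁆ +
      LieAlgebra.LoopAlgebra.residuePairing ℂ ℤ 𝔤 Φ f g • affCen Φ hΦ hΦs :=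
  extLift_lie _ f g

/-- The action of the Virasoro algebra on `𝔤'` by derivations:
`d_n (x ⊗ t^m) = m x ⊗ t^{m+n}`, `d_n K = 0`, and `C` acts by zero. -/
def virAct : Vir →ₗ⁅ℂ⁆ LieDerivation ℂ (Aff Φ hΦ hΦs) (Aff Φ hΦ hΦs) :=
  (extAct (LieAlgebra.LoopAlgebra.twoCocycleOfBilinear ℂ ℤ 𝔤 Φ hΦ hΦs) (loopDer 𝔤)
    (residuePairing_loopAct Φ)).comp (extProj virCocycle)

theorem virAct_affLift (w : Witt) (f : LieAlgebra.loopAlgebra ℂ ℤ 𝔤) :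
    virAct Φ hΦ hΦs (extLift virCocycle w) (affLift Φ hΦ hΦs f) =
      affLift Φ hΦ hΦs (loopAct 𝔤 w f) := rfl

/-- The affine-Virasoro algebra `𝔏 = 𝔤' ⋊ Vir`. -/
def AffVir : Type _ := LieAlgebra.SemiDirectSum (Aff Φ hΦ hΦs) Vir (virAct Φ hΦ hΦs)

instance : LieRing (AffVir Φ hΦ hΦs) :=
  LieAlgebra.SemiDirectSum.instLieRing (virAct Φ hΦ hΦs)

instance : LieAlgebra ℂ (AffVir Φ hΦ hΦs) :=
  LieAlgebra.SemiDirectSum.inst (virAct Φ hΦ hΦs)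

/-- The inclusion of `𝔤'` into `𝔏`. -/
def ofAff : Aff Φ hΦ hΦs →ₗ⁅ℂ⁆ AffVir Φ hΦ hΦs := LieAlgebra.SemiDirectSum.inl (virAct Φ hΦ hΦs)

/-- The inclusion of `Vir` into `𝔏`. -/
def ofVir : Vir →ₗ⁅ℂ⁆ AffVir Φ hΦ hΦs := LieAlgebra.SemiDirectSum.inr (virAct Φ hΦ hΦs)

theorem ofVir_lie_ofAff (w : Vir) (f : Aff Φ hΦ hΦs) :
    ⁅ofVir Φ hΦ hΦs w, ofAff Φ hΦ hΦs f⁆ = ofAff Φ hΦ hΦs (virAct Φ hΦ hΦs w f) := by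
  have h : ⁅LieAlgebra.SemiDirectSum.inr (virAct Φ hΦ hΦs) w,
      LieAlgebra.SemiDirectSum.inl (virAct Φ hΦ hΦs) f⁆ =
      LieAlgebra.SemiDirectSum.inl (virAct Φ hΦ hΦs) (virAct Φ hΦ hΦs w f) := by
    rw [LieAlgebra.SemiDirectSum.lie_eq_mk]
    simp only [LieAlgebra.SemiDirectSum.inl_eq_mk, LieAlgebra.SemiDirectSum.inr_eq_mk, map_zero,
      zero_lie, lie_zero, zero_add, sub_zero]
  exact h

/-- The element `x ⊗ t^n` of `𝔏`, linearly in `x ∈ 𝔤`. -/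
def loopElt (n : ℤ) : 𝔤 →ₗ[ℂ] AffVir Φ hΦ hΦs :=
  (ofAff Φ hΦ hΦs).toLinearMap ∘ₗ affLift Φ hΦ hΦs ∘ₗ
    TensorProduct.mk ℂ (AddMonoidAlgebra ℂ ℤ) 𝔤 (AddMonoidAlgebra.single n 1)

/-- The affine central element `K` of `𝔏`. -/
def affK : AffVir Φ hΦ hΦs := ofAff Φ hΦ hΦs (affCen Φ hΦ hΦs)

/-- The element `d_n` of `𝔏`. -/
def virD (n : ℤ) : AffVir Φ hΦ hΦs := ofVir Φ hΦ hΦs (extLift virCocycle (Witt.basis n))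

/-- The Virasoro central element `C` of `𝔏`. -/
def virC : AffVir Φ hΦ hΦs := ofVir Φ hΦ hΦs (extCen virCocycle)

/-! The defining relations of `𝔏`. -/

theorem loopElt_apply (n : ℤ) (x : 𝔤) : loopElt Φ hΦ hΦs n x =
    ofAff Φ hΦ hΦs (affLift Φ hΦ hΦs (AddMonoidAlgebra.single n 1 ⊗ₜ x)) := rfl

theorem loopElt_lie_loopElt (n m : ℤ) (x y : 𝔤) :
    ⁅loopElt Φ hΦ hΦs n x, loopElt Φ hΦ hΦs m y⁆ = loopElt Φ hΦ hΦs (n + m) ⁅x, y⁆ +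
      (if m = -n then (m : ℂ) * Φ x y else 0) • affK Φ hΦ hΦs := by
  have h := LieAlgebra.ExtendScalars.bracket_tmul ℂ (AddMonoidAlgebra ℂ ℤ) 𝔤 𝔤
    (AddMonoidAlgebra.single n 1) (AddMonoidAlgebra.single m 1) x y
  rw [AddMonoidAlgebra.single_mul_single, mul_one] at h
  rw [loopElt_apply, loopElt_apply, loopElt_apply, affK, ← LieHom.map_lie, affLift_lie, map_add,
    map_smul, h, residuePairing_single Φ n m x y]

theorem virD_lie_virD (n m : ℤ) :
    ⁅virD Φ hΦ hΦs n, virD Φ hΦ hΦs m⁆ = ((m : ℂ) - (n : ℂ)) • virD Φ hΦ hΦs (n + m) +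
      (if m = -n then ((n : ℂ) ^ 3 - (n : ℂ)) / 12 else 0) • virC Φ hΦ hΦs := by
  rw [virD, virD, virD, virC, ← LieHom.map_lie, extLift_lie, map_add, map_smul, Witt.lie_basis,
    map_smul, map_smul, ← Witt.virForm_basis n m]
  rfl

theorem virD_lie_loopElt (n m : ℤ) (x : 𝔤) :
    ⁅virD Φ hΦ hΦs n, loopElt Φ hΦ hΦs m x⁆ = (m : ℂ) • loopElt Φ hΦ hΦs (m + n) x := by
  rw [virD, loopElt_apply, loopElt_apply, ofVir_lie_ofAff, virAct_affLift, loopAct_basis, map_smul,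
    map_smul]

theorem eq_ofAff_add_ofVir (z : AffVir Φ hΦ hΦs) :
    ∃ f w, z = ofAff Φ hΦ hΦs f + ofVir Φ hΦ hΦs w :=
  ⟨LieAlgebra.SemiDirectSum.left z, LieAlgebra.SemiDirectSum.right z,
    LieAlgebra.SemiDirectSum.ext (add_zero (LieAlgebra.SemiDirectSum.left z)).symm
      (zero_add (LieAlgebra.SemiDirectSum.right z)).symm⟩

theorem virAct_affCen (w : Vir) : virAct Φ hΦ hΦs w (affCen Φ hΦ hΦs) = 0 :=
  congrArg (LieAlgebra.ofProd _) (Prod.ext (map_zero (loopAct 𝔤 w.carrier.1)) rfl)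

theorem affK_lie (z : AffVir Φ hΦ hΦs) : ⁅affK Φ hΦ hΦs, z⁆ = 0 := by
  obtain ⟨f, w, rfl⟩ := eq_ofAff_add_ofVir Φ hΦ hΦs z
  have h : ⁅affCen Φ hΦ hΦs, f⁆ = 0 := extCen_lie _ f
  rw [affK, lie_add, ← LieHom.map_lie, h, map_zero, zero_add, ← lie_skew, ofVir_lie_ofAff,
    virAct_affCen, map_zero, neg_zero]

theorem virC_lie (z : AffVir Φ hΦ hΦs) : ⁅virC Φ hΦ hΦs, z⁆ = 0 := by
  obtain ⟨f, w, rfl⟩ := eq_ofAff_add_ofVir Φ hΦ hΦs z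
  have h : virAct Φ hΦ hΦs (extCen virCocycle) f = 0 :=
    congrArg (LieAlgebra.ofProd _)
      (Prod.ext (LinearMap.congr_fun (map_zero (loopAct 𝔤)) f.carrier.1) rfl)
  rw [virC, lie_add, ← LieHom.map_lie, extCen_lie, map_zero, add_zero, ofVir_lie_ofAff, h,
    map_zero]

/-! ### Integrable modules over `𝔏(A) = 𝔏 ⊗ A` -/

/-- The Cartan subalgebra `𝔥 ⊕ ℂ K ⊕ ℂ d_0 ⊕ ℂ C` of `𝔏`, where `𝔥` is the given Cartan subalgebra
of `𝔤`. -/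
def cartan (H : LieSubalgebra ℂ 𝔤) : Submodule ℂ (AffVir Φ hΦ hΦs) :=
  H.toSubmodule.map (loopElt Φ hΦ hΦs 0) ⊔
    Submodule.span ℂ {affK Φ hΦ hΦs, virD Φ hΦ hΦs 0, virC Φ hΦ hΦs}

variable (A : Type*) [CommRing A] [Algebra ℂ A]

/-- The loop affine-Virasoro algebra `𝔏(A)`, with `[a ⊗ X, b ⊗ Y] = ab ⊗ [X, Y]`. -/
abbrev LoopAffVirAlg : Type _ := A ⊗[ℂ] AffVir Φ hΦ hΦs

variable (H : LieSubalgebra ℂ 𝔤)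
variable (V : Type*) [AddCommGroup V] [Module ℂ V]
  [LieRingModule (LoopAffVirAlg Φ hΦ hΦs A) V] [LieModule ℂ (LoopAffVirAlg Φ hΦ hΦs A) V]

/-- The weight space `V_μ = {v | h v = μ(h) v for all h}`, for `μ` a linear form on the Cartan
subalgebra, which sits in `𝔏(A)` as `1 ⊗ h`. -/
def weightSpace (μ : Module.Dual ℂ (cartan Φ hΦ hΦs H)) : Submodule ℂ V where
  carrier := {v | ∀ h : cartan Φ hΦ hΦs H,
    ⁅((1 : A) ⊗ₜ[ℂ] (h : AffVir Φ hΦ hΦs) : LoopAffVirAlg Φ hΦ hΦs A), v⁆ = μ h • v}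
  add_mem' hv hw h := by rw [lie_add, hv h, hw h, smul_add]
  zero_mem' h := by rw [lie_zero, smul_zero]
  smul_mem' c v hv h := by rw [lie_smul, hv h, smul_comm]

open scoped Classical in
/-- Integrable `𝔏(A)`-modules: weight modules (`V = ⨁ V_μ`) with finite-dimensional weight spaces
on which all real root vectors `(x ⊗ t^n) ⊗ a`, with `x` in the root space of a root `α` of `𝔤`,
act locally nilpotently. -/
def IsIntegrable [LieRing.IsNilpotent H] : Prop :=
  DirectSum.IsInternal (weightSpace Φ hΦ hΦs A H V) ∧
  (∀ μ, FiniteDimensional ℂ (weightSpace Φ hΦ hΦs A H V μ)) ∧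
  ∀ α : LieModule.Weight ℂ H 𝔤, α.IsNonZero →
    ∀ x ∈ LieAlgebra.rootSpace H α, ∀ (n : ℤ) (a : A) (v : V), ∃ N : ℕ,
      (LieModule.toEnd ℂ (LoopAffVirAlg Φ hΦ hΦs A) V (a ⊗ₜ[ℂ] loopElt Φ hΦ hΦs n x) ^ N) v = 0

end Affine

end LoopAffVir

end

/-! By Schur's lemma, applied in a nonzero finite-dimensional weight space, `K ⊗ a` acts by a scalar
`c`. Suppose `c ≠ 0`, and fix a root `φ` with an `sl₂`-triple `(e, f, h)`. Two structures then act
on `V` and are incompatible.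

Since `K ⊗ 1` acts by zero, `e ⊗ t^n`, `f ⊗ t^{-n}`, `h` form an integrable `sl₂`-triple for every
`n`, with the same `h`. Composing reflections for two such `n` bounds `dim V_{μ + mqδ}` by `dim V_μ`
for all `q ∈ ℤ` whenever `μ(h) = m ≥ 0` (`finrank_weightSpace_translate_le`).

On the other hand `(h ⊗ t^n) ⊗ a` and `(h ⊗ t^{-n}) ⊗ 1`, `n > 0`, generate an infinite Weyl algebra
with `[P_n, Q_n] = -n Φ(h, h) c ≠ 0`. Such an algebra makes the dimensions of the `V_{μ + mqδ}`
unbounded as soon as `V_μ ≠ 0` and `m > 0` (`weyl_dim_unbounded`).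

Hence no weight is positive on `h`. The same argument for `-φ` excludes negative values, and values
on `h` are integers, so every weight vanishes on `h`. But `e ⊗ t^n ⊗ b` raises the value on `h` by
2, so it acts by zero. Comparing `[e ⊗ a, f]` with `[e ⊗ t^{-1} ⊗ a, f ⊗ t]` isolates `Φ(e, f) K ⊗
a`, which must therefore act by zero, and `Φ(e, f) ≠ 0`. -/

namespace LoopAffVir

/-! ### Linear algebra of integrable `sl₂`-actions and commuting operators. -/

section LinearAlgebra

variable {V : Type*} [AddCommGroup V] [Module ℂ V]

/-- A triple of operators satisfying the `sl₂` relations. -/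
structure IsSl2Action (E F H : Module.End ℂ V) : Prop where
  ef : ∀ v, E (F v) = F (E v) + H v
  he : ∀ v, H (E v) = E (H v) + (2 : ℂ) • E v
  hf : ∀ v, H (F v) = F (H v) - (2 : ℂ) • F v

namespace IsSl2Action

variable {E F H : Module.End ℂ V}

theorem symm (t : IsSl2Action E F H) : IsSl2Action F E (-H) where
  ef v := by rw [t.ef]; simp
  he v := by simp only [LinearMap.neg_apply, t.hf, map_neg]; abel
  hf v := by simp only [LinearMap.neg_apply, t.he, map_neg]; abel

theorem h_pow_e (t : IsSl2Action E F H) {v : V} {μ : ℂ} (hv : H v = μ • v) (k : ℕ) :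
    H ((E ^ k) v) = (μ + 2 * k) • (E ^ k) v := by
  induction k with
  | zero => simpa using hv
  | succ k ih =>
    rw [pow_succ', Module.End.mul_apply, t.he, ih, map_smul]
    push_cast
    module

/-- Moving `F` past each further `E` contributes the current weight, and `μ + (μ + 2) + ⋯ + (μ + 2k)
= (k + 1)(μ + k)`. -/
theorem e_pow_succ_f (t : IsSl2Action E F H) {v : V} {μ : ℂ} (hv : H v = μ • v) (k : ℕ) :
    (E ^ (k + 1)) (F v) = F ((E ^ (k + 1)) v) + ((k + 1) * (μ + k)) • (E ^ k) v := by
  induction k with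
  | zero => simp [t.ef, hv]
  | succ k ih =>
    rw [pow_succ', Module.End.mul_apply, ih, map_add, t.ef, ← Module.End.mul_apply E, ← pow_succ',
      t.h_pow_e hv, map_smul, ← Module.End.mul_apply E, ← pow_succ']
    push_cast
    module

theorem f_pow_succ_e (t : IsSl2Action E F H) {v : V} {μ : ℂ} (hv : H v = μ • v) (k : ℕ) :
    (F ^ (k + 1)) (E v) = E ((F ^ (k + 1)) v) - ((k + 1) * (μ - k)) • (F ^ k) v := by
  have hv' : (-H) v = (-μ) • v := by rw [LinearMap.neg_apply, hv, neg_smul]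
  rw [t.symm.e_pow_succ_f hv']
  module

/-- Only an eigenvector of `F E` is needed, not a highest weight vector; the latter is the case `l =
0`. -/
theorem e_f_pow_succ (t : IsSl2Action E F H) {v : V} {μ l : ℂ} (hv : H v = μ • v)
    (hl : F (E v) = l • v) (j : ℕ) :
    E ((F ^ (j + 1)) v) = (l + (j + 1) * (μ - j)) • (F ^ j) v := by
  have h := t.f_pow_succ_e hv j
  rw [pow_succ, Module.End.mul_apply, hl, map_smul, ← pow_succ] at h
  rw [add_smul, h]
  abel

/-- On the weight space of weight `m`, the operator `F ^ m` is injective. -/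
theorem eq_zero_of_pow_f (t : IsSl2Action E F H) (m k : ℕ) :
    ∀ {v : V}, H v = (m : ℂ) • v → (E ^ k) v = 0 → (F ^ m) v = 0 → v = 0 := by
  induction k with
  | zero => intro v _ h _; simpa using h
  | succ k ih =>
    intro v hv hE hF
    -- The constant is the one with `E^k F E v = F E^{k+1} v + k (m + k + 1) E^k v`. Thus `E^k`
    -- kills this difference, which again has weight `m` and is killed by `F^m`, so the induction
    -- hypothesis applies.
    have hu : F (E v) - ((k : ℂ) * (m + k + 1)) • v = 0 := by
      apply ih
      · simp only [map_sub, map_smul, t.hf, t.he, hv, map_add]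
        module
      · rw [map_sub, map_smul]
        cases k with
        | zero =>
          simp only [zero_add, pow_one] at hE
          simp [hE]
        | succ k =>
          have hw : H (E v) = ((m : ℂ) + 2) • E v := by rw [t.he, hv, map_smul]; module
          rw [t.e_pow_succ_f hw, ← Module.End.mul_apply _ E, ← Module.End.mul_apply _ E,
            ← pow_succ, ← pow_succ, hE]
          push_cast
          rw [map_zero]
          module
      · rw [map_sub, map_smul, hF, smul_zero, sub_zero]
        cases m with
        | zero => simp_all
        | succ m =>
          rw [← Module.End.mul_apply, ← pow_succ, pow_succ', Module.End.mul_apply,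
            t.f_pow_succ_e hv, hF, map_zero, zero_sub, map_neg, map_smul, ← Module.End.mul_apply F,
            ← pow_succ', hF, smul_zero, neg_zero]
    rw [sub_eq_zero] at hu
    -- As `v` is now an eigenvector of `F E`, applying `E` to `F^{i+1} v = 0` gives a multiple of
    -- `F^i v`. For `i < m` the coefficient is a positive integer, so the vanishing descends from
    -- `F^m v` to `v`.
    have key : ∀ j ≤ m, (F ^ (m - j)) v = 0 := by
      intro j
      induction j with
      | zero => intro _; simpa using hF
      | succ j ihj =>
        intro hj
        obtain ⟨i, hi⟩ : ∃ i, m = i + (j + 1) := ⟨m - (j + 1), by omega⟩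
        have h1 : m - j = i + 1 := by omega
        have h2 : m - (j + 1) = i := by omega
        have h := t.e_f_pow_succ hv hu i
        rw [← h1, ihj (by omega), map_zero, eq_comm, smul_eq_zero] at h
        rw [h2]
        refine h.resolve_left ?_
        subst hi
        have : ((k : ℂ) * (((i + (j + 1) : ℕ) : ℂ) + k + 1) +
            (i + 1) * (((i + (j + 1) : ℕ) : ℂ) - i)) =
            ((k * (i + (j + 1) + k + 1) + (i + 1) * (j + 1) : ℕ) : ℂ) := by push_cast; ring
        rw [this, ← ne_eq, Nat.cast_ne_zero]
        positivity
    simpa using key m le_rfl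

theorem exists_last_ne_zero {T : Module.End ℂ V} {v : V} (hv : v ≠ 0) (h : ∃ N : ℕ, (T ^ N) v = 0) :
    ∃ k : ℕ, (T ^ k) v ≠ 0 ∧ T ((T ^ k) v) = 0 := by
  obtain ⟨n, h1, h2⟩ := Nat.exists_not_and_succ_of_not_zero_of_exists (p := fun N => (T ^ N) v = 0)
    (by simpa using hv) h
  exact ⟨n, h1, by rwa [pow_succ', Module.End.mul_apply] at h2⟩

/-- The weights of an integrable `sl₂`-action are integers. -/
theorem exists_int (t : IsSl2Action E F H) {v : V} {μ : ℂ} (hv : H v = μ • v) (h0 : v ≠ 0)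
    (hE : ∀ w, ∃ N : ℕ, (E ^ N) w = 0) (hF : ∀ w, ∃ N : ℕ, (F ^ N) w = 0) :
    ∃ m : ℤ, μ = m := by
  -- `E^k v` is a highest weight vector of weight `μ + 2k`. If `F^j` is the last power not killing
  -- it, then `(j + 1)(μ + 2k - j) = 0`.
  obtain ⟨k, hk, hk'⟩ := exists_last_ne_zero h0 (hE v)
  obtain ⟨j, hj, hj'⟩ := exists_last_ne_zero hk (hF _)
  have h := t.e_f_pow_succ (t.h_pow_e hv k) (l := 0) (by rw [hk', map_zero, zero_smul]) j
  rw [pow_succ', Module.End.mul_apply, hj', map_zero, eq_comm, smul_eq_zero] at h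
  have h := (mul_eq_zero.mp ((zero_add _).symm.trans (h.resolve_right hj))).resolve_left
    (Nat.cast_add_one_ne_zero j)
  refine ⟨j - 2 * k, ?_⟩
  push_cast
  linear_combination h

end IsSl2Action

/-- Finitely many commuting operators that preserve a nonzero finite-dimensional subspace have a
common eigenvector in it. -/
theorem exists_common_eigenvector {ι : Type*} (T : ι → Module.End ℂ V)
    (hT : ∀ i j, Commute (T i) (T j)) (s : Finset ι) (W : Submodule ℂ V) [FiniteDimensional ℂ W]
    (hW : W ≠ ⊥) (hTW : ∀ i, ∀ w ∈ W, T i w ∈ W) :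
    ∃ v ∈ W, v ≠ 0 ∧ ∀ i ∈ s, ∃ l : ℂ, T i v = l • v := by
  classical
  induction s using Finset.induction_on generalizing W with
  | empty =>
    obtain ⟨v, hv, h0⟩ := Submodule.exists_mem_ne_zero_of_ne_bot hW
    exact ⟨v, hv, h0, by simp⟩
  | insert i s _ ih =>
    have : Nontrivial W := Submodule.nontrivial_iff_ne_bot.mpr hW
    obtain ⟨l, hl⟩ := Module.End.exists_eigenvalue ((T i).restrict (hTW i))
    obtain ⟨w, hw, hw0⟩ := hl.exists_hasEigenvector
    have hw' : T i w = l • (w : V) :=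
      congrArg Subtype.val (Module.End.mem_eigenspace_iff.mp hw)
    -- The remaining operators commute with `T i`, so they preserve this eigenspace and the
    -- induction continues inside it.
    have : FiniteDimensional ℂ ↥(W ⊓ Module.End.eigenspace (T i) l) :=
      Submodule.finiteDimensional_inf_left _ _
    obtain ⟨v, hv, hv0, hvs⟩ := ih (W ⊓ Module.End.eigenspace (T i) l)
      (Submodule.ne_bot_iff _ |>.mpr ⟨w, ⟨w.2, Module.End.mem_eigenspace_iff.mpr hw'⟩,
        by simpa using hw0⟩)
      (fun j w hw => ⟨hTW j w hw.1, Module.End.mem_eigenspace_iff.mpr (by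
        rw [← Module.End.mul_apply, (hT i j).eq, Module.End.mul_apply,
          Module.End.mem_eigenspace_iff.mp hw.2, map_smul])⟩)
    refine ⟨v, hv.1, hv0, fun j hj => ?_⟩
    rcases Finset.mem_insert.mp hj with rfl | hj
    · exact ⟨l, Module.End.mem_eigenspace_iff.mp hv.2⟩
    · exact hvs j hj

/-! ### Weyl algebras and growth of graded dimensions. -/

section Weyl

/-- Each application of `P` lowers the eigenvalue of `Q P` by `c`. -/
theorem weyl_pow_left {P Q : Module.End ℂ V} {c l : ℂ} (h : ∀ v, P (Q v) = Q (P v) + c • v) {v : V}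
    (hv : Q (P v) = l • v) (k : ℕ) : Q ((P ^ (k + 1)) v) = (l - k * c) • (P ^ k) v := by
  induction k with
  | zero => simpa using hv
  | succ k ih =>
    have := h ((P ^ (k + 1)) v)
    rw [ih, map_smul, ← Module.End.mul_apply P, ← pow_succ', ← Module.End.mul_apply P,
      ← pow_succ'] at this
    rw [← sub_eq_iff_eq_add.mpr this]
    push_cast
    module

/-- An eigenvector of `Q P`, where `[P, Q]` is a nonzero scalar, cannot be annihilated both by a
power of `P` and by a power of `Q`. -/
theorem weyl_dichotomy {P Q : Module.End ℂ V} {c l : ℂ} (hc : c ≠ 0)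
    (h : ∀ v, P (Q v) = Q (P v) + c • v) {v : V} (h0 : v ≠ 0) (hv : Q (P v) = l • v) :
    (∀ k, (P ^ k) v ≠ 0) ∨ ∀ k, (Q ^ k) v ≠ 0 := by
  by_contra! hcon
  obtain ⟨i, hi, hi'⟩ := IsSl2Action.exists_last_ne_zero h0 hcon.1
  obtain ⟨j, hj, hj'⟩ := IsSl2Action.exists_last_ne_zero h0 hcon.2
  have h1 := weyl_pow_left h hv i
  have h2 := weyl_pow_left (P := Q) (Q := P) (c := -c) (l := l + c) (fun v => by rw [h]; simp)
    (by rw [h, hv, add_smul]) j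
  rw [pow_succ', Module.End.mul_apply, hi', map_zero, eq_comm, smul_eq_zero] at h1
  rw [pow_succ', Module.End.mul_apply, hj', map_zero, eq_comm, smul_eq_zero] at h2
  have h1 := h1.resolve_right hi
  have h2 := h2.resolve_right hj
  -- Termination of the `P`-orbit forces `l = i c`; termination of the `Q`-orbit forces `l = -(j +
  -- 1) c`.
  have h3 : ((i + j + 1 : ℕ) : ℂ) * c = 0 := by push_cast; linear_combination h2 - h1
  rcases mul_eq_zero.mp h3 with h3 | h3
  · exact absurd (Nat.cast_eq_zero.mp h3) (by omega)
  · exact hc h3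

/-- The commuting operators `Q j P j` separate the vectors: on `P i ^ k i v` the eigenvalue is still
`l j` for `j ≠ i`, but is shifted by `-k i * c i ≠ 0` for `j = i`. Hence `Q j P j - l j` kills every
term of a linear relation except the `j`-th. -/
theorem weyl_linearIndependent {ι : Type*} [DecidableEq ι] (P Q : ι → Module.End ℂ V) (c : ι → ℂ)
    (hc : ∀ i, c i ≠ 0) (hP : ∀ i j, Commute (P i) (P j))
    (hPQ : ∀ i j v, P i (Q j v) = Q j (P i v) + (if i = j then c i else 0) • v)
    {v : V} (hv : ∀ i, ∃ l : ℂ, Q i (P i v) = l • v) (k : ι → ℕ) (hk : ∀ i, k i ≠ 0)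
    (hne : ∀ i, (P i ^ k i) v ≠ 0) : LinearIndependent ℂ fun i => (P i ^ k i) v := by
  choose l hl using hv
  have hd : ∀ i, Q i (P i ((P i ^ k i) v)) = (l i - k i * c i) • (P i ^ k i) v := fun i => by
    rw [← Module.End.mul_apply (P i), ← pow_succ']
    exact weyl_pow_left (fun v => by simpa using hPQ i i v) (hl i) (k i)
  have ho : ∀ i j, i ≠ j → Q j (P j ((P i ^ k i) v)) = l j • (P i ^ k i) v := fun i j hij => by
    have h1 : Commute (P i) (Q j) := LinearMap.ext fun v => by simpa [hij] using hPQ i j v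
    have h2 : Commute (P i ^ k i) (Q j * P j) := (h1.mul_right (hP i j)).pow_left _
    rw [← Module.End.mul_apply, ← Module.End.mul_apply, ← h2.eq, Module.End.mul_apply,
      Module.End.mul_apply, hl, map_smul]
  rw [linearIndependent_iff']
  intro s g hg j hj
  have h := congrArg (fun w => Q j (P j w) - l j • w) hg
  simp only [map_sum, map_smul, map_zero, smul_zero, sub_zero, Finset.smul_sum,
    ← Finset.sum_sub_distrib] at h
  rw [Finset.sum_eq_single j (fun i _ hij => by rw [ho i j hij, smul_comm, sub_self])
    (fun h => absurd hj h), hd, smul_comm (l j), ← smul_sub, ← sub_smul, smul_smul,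
    smul_eq_zero] at h
  refine (mul_eq_zero.mp (h.resolve_right (hne j))).resolve_right ?_
  rw [sub_sub_cancel_left, ← ne_eq, neg_ne_zero]
  exact mul_ne_zero (Nat.cast_ne_zero.mpr (hk j)) (hc j)

theorem pow_apply_mem_of_shift {D : ℤ → Submodule ℂ V} {T : Module.End ℂ V} {n : ℤ}
    (hT : ∀ k, ∀ v ∈ D k, T v ∈ D (k + n)) {v : V} {k : ℤ} (hv : v ∈ D k) (j : ℕ) :
    (T ^ j) v ∈ D (k + j * n) := by
  induction j with
  | zero => simpa using hv
  | succ j ih =>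
    rw [pow_succ', Module.End.mul_apply]
    convert hT _ _ ih using 2
    push_cast
    ring

/-- A graded space with an action of the infinite Weyl algebra, with one pair of generators in each
pair `(n, -n)` of nonzero degrees, has no bound on the dimensions of its components in the degrees
divisible by a given integer. -/
theorem weyl_dim_unbounded (P Q : ℕ → Module.End ℂ V) (c : ℕ → ℂ) (hc : ∀ i, 0 < i → c i ≠ 0)
    (hP : ∀ i j, 0 < i → 0 < j → Commute (P i) (P j))
    (hQ : ∀ i j, 0 < i → 0 < j → Commute (Q i) (Q j))
    (hPQ : ∀ i j, 0 < i → 0 < j → ∀ v, P i (Q j v) = Q j (P i v) + (if i = j then c i else 0) • v)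
    (D : ℤ → Submodule ℂ V) (hPD : ∀ (i : ℕ) (k : ℤ), ∀ v ∈ D k, P i v ∈ D (k + i))
    (hQD : ∀ (i : ℕ) (k : ℤ), ∀ v ∈ D k, Q i v ∈ D (k + -i)) (h0 : D 0 ≠ ⊥)
    (hfin : ∀ k, FiniteDimensional ℂ (D k)) (m : ℕ) (hm : m ≠ 0) (d : ℕ)
    (hd : ∀ q : ℤ, Module.finrank ℂ (D (m * q)) ≤ d) : False := by
  classical
  -- The products `Q_n P_n` commute and have degree zero. With `2d + 1` of them, one alternative of
  -- `weyl_dichotomy` must occur at least `d + 1` times.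
  obtain ⟨v, hvD, hv0, hv⟩ := exists_common_eigenvector (fun i : ℕ => Q (i + 1) * P (i + 1))
    (fun i j => by
      by_cases hij : i = j
      · subst hij; exact Commute.refl _
      have h1 : ∀ i j, i ≠ j → Commute (P (i + 1)) (Q (j + 1)) := fun i j hij =>
        LinearMap.ext fun v => by simpa [hij] using hPQ (i + 1) (j + 1) (by omega) (by omega) v
      exact ((hQ _ _ (by omega) (by omega)).mul_right (h1 j i (Ne.symm hij)).symm).mul_left
        ((h1 i j hij).mul_right (hP _ _ (by omega) (by omega))))
    (Finset.range (2 * d + 1)) (D 0) h0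
    (fun i w hw => by
      have := hQD (i + 1) _ _ (hPD (i + 1) _ _ hw)
      rwa [add_neg_cancel_right] at this)
  -- the indices whose `X`-orbit is infinite give independent vectors in one degree
  have key : ∀ (X Y : ℕ → Module.End ℂ V) (c : ℕ → ℂ) (ε : ℤ), (∀ i, 0 < i → c i ≠ 0) →
      (∀ i j, 0 < i → 0 < j → Commute (X i) (X j)) →
      (∀ i j, 0 < i → 0 < j → ∀ v, X i (Y j v) = Y j (X i v) + (if i = j then c i else 0) • v) →
      (∀ (i : ℕ) (k : ℤ), ∀ v ∈ D k, X i v ∈ D (k + ε * i)) →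
      ∀ s : Finset ℕ, (∀ i ∈ s, ∃ l : ℂ, Y (i + 1) (X (i + 1) v) = l • v) →
      (∀ i ∈ s, ∀ k, (X (i + 1) ^ k) v ≠ 0) → s.card ≤ d := by
    intro X Y c ε hc hX hXY hXD s hs hne
    -- `N` is a common multiple of the degrees `i + 1`, so the powers `X_{i+1} ^ (mN / (i+1))` all
    -- move `v` to the single degree `ε m N`, where at most `d` vectors can be independent.
    set N := ∏ i ∈ s, (i + 1) with hN
    have hN0 : N ≠ 0 := Finset.prod_ne_zero_iff.mpr fun i _ => by omega
    have hdvd : ∀ i ∈ s, (i + 1) ∣ N := fun i hi => Finset.dvd_prod_of_mem (fun i => i + 1) hi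
    have hq : ∀ i : s, m * N / (i + 1) * ((i : ℕ) + 1) = m * N := fun i =>
      Nat.div_mul_cancel (Dvd.dvd.mul_left (hdvd i i.2) m)
    have hli := weyl_linearIndependent (ι := s) (fun i => X (i + 1)) (fun i => Y (i + 1))
      (fun i => c (i + 1)) (fun i => hc _ (by omega)) (fun i j => hX _ _ (by omega) (by omega))
      (fun i j v => by
        rw [hXY _ _ (by omega) (by omega)]
        simp only [Nat.add_right_cancel_iff, Subtype.ext_iff])
      (fun i => hs i i.2) (fun i => m * N / (i + 1))
      (fun i h => by
        have := hq i
        rw [h, zero_mul] at this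
        exact mul_ne_zero hm hN0 this.symm)
      (fun i => hne i i.2 _)
    have hmem : ∀ i : s, (X (i + 1) ^ (m * N / (i + 1))) v ∈ D (m * (ε * N)) := fun i => by
      have h := pow_apply_mem_of_shift (hXD (i + 1)) hvD (m * N / ((i : ℕ) + 1))
      convert h using 2
      have h' : ((m * N / ((i : ℕ) + 1) : ℕ) : ℤ) * (((i : ℕ) + 1 : ℕ) : ℤ) = m * N := by
        exact_mod_cast hq i
      linear_combination (-ε) * h'
    have hli' : LinearIndependent ℂ fun i : s =>
        (⟨_, hmem i⟩ : D (m * (ε * N))) := LinearIndependent.of_comp (D (m * (ε * N))).subtype hli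
    have := hfin (m * (ε * N))
    simpa using hli'.fintype_card_le_finrank.trans (hd (ε * N))
  have h1 := key P Q c 1 hc hP hPQ (fun i k v hv => by simpa using hPD i k v hv)
    ((Finset.range (2 * d + 1)).filter fun i => ∀ k, (P (i + 1) ^ k) v ≠ 0)
    (fun i hi => hv i (Finset.mem_filter.mp hi).1) (fun i hi => (Finset.mem_filter.mp hi).2)
  -- Exchanging `P` and `Q` changes the sign of the commutator and of the degree, and `P Q v = (l +
  -- c) v`.
  have h2 := key Q P (fun i => -c i) (-1) (fun i hi => neg_ne_zero.mpr (hc i hi)) hQ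
    (fun i j hi hj v => by
      rw [hPQ j i hj hi]
      by_cases h : i = j
      · subst h; simp
      · simp [h, Ne.symm h])
    (fun i k v hv => by simpa using hQD i k v hv)
    ((Finset.range (2 * d + 1)).filter fun i => ¬ ∀ k, (P (i + 1) ^ k) v ≠ 0)
    (fun i hi => by
      obtain ⟨l, hl⟩ := hv i (Finset.mem_filter.mp hi).1
      refine ⟨l + c (i + 1), ?_⟩
      have := hPQ (i + 1) (i + 1) (by omega) (by omega) v
      rw [this, if_pos rfl, add_smul, ← hl]
      rfl)
    (fun i hi => by
      obtain ⟨l, hl⟩ := hv i (Finset.mem_filter.mp hi).1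
      exact (weyl_dichotomy (hc (i + 1) (by omega))
        (fun v => by simpa using hPQ (i + 1) (i + 1) (by omega) (by omega) v) hv0 hl).resolve_left
          (Finset.mem_filter.mp hi).2)
  have h3 := Finset.card_filter_add_card_filter_not (s := Finset.range (2 * d + 1))
    fun i => ∀ k, (P (i + 1) ^ k) v ≠ 0
  rw [Finset.card_range] at h3
  omega

end Weyl

end LinearAlgebra

end LoopAffVir

noncomputable section

namespace LoopAffVir

/-! ### Root triples and the invariant form. -/

section Roots

variable {𝔤 : Type*} [LieRing 𝔤] [LieAlgebra ℂ 𝔤]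

/-- An `sl₂`-triple `(e, f, h)` with `h` in `H`, whose nilpotent elements are weight vectors of
weights `±φ` for `H`, and with `Φ(e, f) ≠ 0`. -/
structure IsRootTriple (H : LieSubalgebra ℂ 𝔤) (Φ : LinearMap.BilinForm ℂ 𝔤)
    (φ : Module.Dual ℂ 𝔤) (e f h : 𝔤) : Prop where
  h_mem : h ∈ H
  lie_e_f : ⁅e, f⁆ = h
  lie_h : ∀ x ∈ H, ⁅x, h⁆ = 0
  lie_e : ∀ x ∈ H, ⁅x, e⁆ = φ x • e
  lie_f : ∀ x ∈ H, ⁅x, f⁆ = (-φ) x • f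
  apply_h : φ h = 2
  form_ne_zero : Φ e f ≠ 0

variable {H : LieSubalgebra ℂ 𝔤} {Φ : LinearMap.BilinForm ℂ 𝔤} {φ : Module.Dual ℂ 𝔤} {e f h : 𝔤}

theorem IsRootTriple.symm (t : IsRootTriple H Φ φ e f h) (hΦs : Φ.IsSymm) :
    IsRootTriple H Φ (-φ) f e (-h) where
  h_mem := neg_mem t.h_mem
  lie_e_f := by rw [← lie_skew, t.lie_e_f]
  lie_h x hx := by rw [lie_neg, t.lie_h x hx, neg_zero]
  lie_e := t.lie_f
  lie_f := by simpa using t.lie_e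
  apply_h := by simp [t.apply_h]
  form_ne_zero := by rw [← hΦs.eq]; exact t.form_ne_zero

/-- Invariance gives `Φ(h, h) = Φ([e, f], h) = 2 Φ(f, e)`. This makes the Weyl algebra generated by
the `h ⊗ t^n` nondegenerate. -/
theorem IsRootTriple.form_h_ne_zero (t : IsRootTriple H Φ φ e f h) (hΦ : Φ.lieInvariant 𝔤)
    (hΦs : Φ.IsSymm) : Φ h h ≠ 0 := by
  have h1 : ⁅e, h⁆ = (-2 : ℂ) • e := by
    rw [← lie_skew, t.lie_e h t.h_mem, t.apply_h, neg_smul]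
  have h2 := hΦ e f h
  rw [t.lie_e_f, h1] at h2
  rw [h2, map_smul, smul_eq_mul]
  simpa using (t.symm hΦs).form_ne_zero

end Roots

/-! ### Existence of root triples. -/

section Killing

variable {𝔤 : Type*} [LieRing 𝔤] [LieAlgebra ℂ 𝔤] [FiniteDimensional ℂ 𝔤]
  [LieAlgebra.IsKilling ℂ 𝔤] {H : LieSubalgebra ℂ 𝔤} [H.IsCartanSubalgebra]

/-- The roots span the dual of `H`, so without roots `H = 0`; but then `𝔤` is its own zero root
space, which is `H`. -/
theorem exists_isNonZero_weight [Nontrivial 𝔤] : ∃ α : LieModule.Weight ℂ H 𝔤, α.IsNonZero := by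
  by_contra! hcon
  have h := LieAlgebra.IsKilling.span_weight_isNonZero_eq_top ℂ 𝔤 H
  have h0 : {α : LieModule.Weight ℂ H 𝔤 | α.IsNonZero} = ∅ :=
    Set.eq_empty_of_forall_notMem fun α hα => hα (hcon α)
  rw [h0, Set.image_empty, Submodule.span_empty] at h
  have h1 : Subsingleton (Module.Dual ℂ H) := (Submodule.subsingleton_iff ℂ).mp
    (subsingleton_of_bot_eq_top h)
  have h2 : Subsingleton H := (Module.subsingleton_dual_iff ℂ).mp h1
  have h3 : (⊤ : LieSubmodule ℂ H 𝔤) ≤ LieAlgebra.rootSpace H 0 := by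
    rw [← LieModule.iSup_genWeightSpace_eq_top' ℂ H 𝔤]
    refine iSup_le fun α => ?_
    have : (α : H → ℂ) = 0 := by
      exact hcon α
    rw [this]
  rw [LieAlgebra.rootSpace_zero_eq] at h3
  obtain ⟨x, hx⟩ := exists_ne (0 : 𝔤)
  exact hx (congrArg Subtype.val (Subsingleton.elim (⟨x, h3 (LieSubmodule.mem_top x)⟩ : H) 0))

/-- By invariance `e` is orthogonal to every root space except that of `-α`, which is the line
through `f`. If also `Φ(e, f) = 0`, then `e` lies in the radical. -/
theorem form_ne_zero_of_rootSpace {Φ : LinearMap.BilinForm ℂ 𝔤} (hΦ : Φ.lieInvariant 𝔤)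
    (hΦn : Φ.Nondegenerate) {α : LieModule.Weight ℂ H 𝔤} (hα : α.IsNonZero) {e f : 𝔤}
    (he : e ∈ LieAlgebra.rootSpace H α) (hf : f ∈ LieAlgebra.rootSpace H (-α)) (he0 : e ≠ 0)
    (hf0 : f ≠ 0) : Φ e f ≠ 0 := by
  intro h0
  refine he0 (hΦn.1 e fun y => ?_)
  suffices h : (⊤ : Submodule ℂ 𝔤) ≤ LinearMap.ker (Φ e) from h Submodule.mem_top
  rw [← LieSubmodule.top_toSubmodule (R := ℂ) (L := H),
    ← LieModule.iSup_genWeightSpace_eq_top' ℂ H 𝔤, LieSubmodule.iSup_toSubmodule]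
  refine iSup_le fun β y (hy : y ∈ LieAlgebra.rootSpace H β) => ?_
  rw [LinearMap.mem_ker]
  by_contra hne
  have hβ : β = -α := by
    refine LieModule.Weight.ext fun x => ?_
    have h1 : ⁅(x : 𝔤), e⁆ = α x • e := LieAlgebra.IsKilling.lie_eq_smul_of_mem_rootSpace he x
    have h2 : ⁅(x : 𝔤), y⁆ = β x • y := LieAlgebra.IsKilling.lie_eq_smul_of_mem_rootSpace hy x
    have h3 := hΦ x e y
    rw [h1, h2, map_smul, map_smul, LinearMap.smul_apply, smul_eq_mul, smul_eq_mul] at h3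
    have h4 : (β x + α x) * Φ e y = 0 := by linear_combination h3
    exact eq_neg_of_add_eq_zero_left ((mul_eq_zero.mp h4).resolve_right hne)
  subst hβ
  obtain ⟨c, hc⟩ := (finrank_eq_one_iff_of_nonzero' (⟨f, hf⟩ : LieAlgebra.rootSpace H (-α))
    (by simpa using hf0)).mp (LieAlgebra.IsKilling.finrank_rootSpace_eq_one (-α) hα.neg) ⟨y, hy⟩
  have hc : c • f = y := congrArg Subtype.val hc
  rw [← hc, map_smul, h0, smul_zero] at hne
  exact hne rfl

theorem exists_isRootTriple [Nontrivial 𝔤] {Φ : LinearMap.BilinForm ℂ 𝔤} (hΦ : Φ.lieInvariant 𝔤)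
    (hΦn : Φ.Nondegenerate) :
    ∃ (α : LieModule.Weight ℂ H 𝔤) (φ : Module.Dual ℂ 𝔤) (e f h : 𝔤), α.IsNonZero ∧
      e ∈ LieAlgebra.rootSpace H α ∧ f ∈ LieAlgebra.rootSpace H (-α) ∧
      IsRootTriple H Φ φ e f h := by
  obtain ⟨α, hα⟩ := exists_isNonZero_weight (𝔤 := 𝔤) (H := H)
  obtain ⟨h, e, f, t, he, hf⟩ := LieAlgebra.IsKilling.exists_isSl2Triple_of_weight_isNonZero hα
  -- The extension of `α` to `𝔤` is arbitrary; only its values on `H` matter.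
  obtain ⟨φ, hφ⟩ := LinearMap.exists_extend (p := H.toSubmodule) α.toLinear
  have hφ' : ∀ x : H, φ x = α x := fun x => LinearMap.congr_fun hφ x
  have hh := t.h_eq_coroot hα he hf
  have hH : h ∈ H := hh ▸ Submodule.coe_mem _
  refine ⟨α, φ, e, f, h, hα, he, hf, hH, t.lie_e_f, fun x hx => ?_, fun x hx => ?_, fun x hx => ?_,
    ?_, form_ne_zero_of_rootSpace hΦ hΦn hα he hf t.e_ne_zero t.f_ne_zero⟩
  · exact congrArg Subtype.val (LieModule.IsTrivial.trivial (⟨x, hx⟩ : H) (⟨h, hH⟩ : H))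
  · rw [hφ' ⟨x, hx⟩]
    exact LieAlgebra.IsKilling.lie_eq_smul_of_mem_rootSpace he ⟨x, hx⟩
  · rw [LinearMap.neg_apply, hφ' ⟨x, hx⟩]
    exact LieAlgebra.IsKilling.lie_eq_smul_of_mem_rootSpace hf ⟨x, hx⟩
  · rw [hh, hφ' (LieAlgebra.IsKilling.coroot α), LieAlgebra.IsKilling.root_apply_coroot hα]

end Killing

/-! ### Weights of loop elements under the extended Cartan subalgebra. -/

section Weights

variable {𝔤 : Type*} [LieRing 𝔤] [LieAlgebra ℂ 𝔤] {Φ : LinearMap.BilinForm ℂ 𝔤}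
  {hΦ : Φ.lieInvariant 𝔤} {hΦs : Φ.IsSymm} {H : LieSubalgebra ℂ 𝔤}

variable (Φ hΦ hΦs) in
/-- The linear form on `𝔏` that takes `d_0` to `1`, and vanishes on the other `d_n`, on `C` and on
`𝔤'`. -/
def degreeForm : AffVir Φ hΦ hΦs →ₗ[ℂ] ℂ :=
  Witt.basis.coord 0 ∘ₗ (extProj virCocycle).toLinearMap ∘ₗ
    (LieAlgebra.SemiDirectSum.projr (virAct Φ hΦ hΦs)).toLinearMap

variable (Φ hΦ hΦs) in
/-- The linear map `𝔏 → 𝔤` that takes `x ⊗ t^0` to `x`, and vanishes on the other `x ⊗ t^n`, on `K`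
and on `Vir`. -/
def constTerm : AffVir Φ hΦ hΦs →ₗ[ℂ] 𝔤 :=
  (TensorProduct.lid ℂ 𝔤).toLinearMap ∘ₗ
    LinearMap.rTensor 𝔤 ((AddMonoidAlgebra.basis ℤ ℂ).coord 0) ∘ₗ
    (extProj (LieAlgebra.LoopAlgebra.twoCocycleOfBilinear ℂ ℤ 𝔤 Φ hΦ hΦs)).toLinearMap ∘ₗ
    LieAlgebra.SemiDirectSum.projl (virAct Φ hΦ hΦs)

theorem degreeForm_ofAff (x : Aff Φ hΦ hΦs) : degreeForm Φ hΦ hΦs (ofAff Φ hΦ hΦs x) = 0 :=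
  map_zero (Witt.basis.coord 0)

theorem degreeForm_ofVir (w : Vir) :
    degreeForm Φ hΦ hΦs (ofVir Φ hΦ hΦs w) = Witt.basis.coord 0 w.carrier.1 := rfl

theorem constTerm_ofAff_affLift (x : LieAlgebra.loopAlgebra ℂ ℤ 𝔤) :
    constTerm Φ hΦ hΦs (ofAff Φ hΦ hΦs (affLift Φ hΦ hΦs x)) =
      TensorProduct.lid ℂ 𝔤 (LinearMap.rTensor 𝔤 ((AddMonoidAlgebra.basis ℤ ℂ).coord 0) x) := rfl

theorem constTerm_affK : constTerm Φ hΦ hΦs (affK Φ hΦ hΦs) = 0 :=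
  (congrArg (TensorProduct.lid ℂ 𝔤)
    (map_zero (LinearMap.rTensor 𝔤 ((AddMonoidAlgebra.basis ℤ ℂ).coord 0)))).trans (map_zero _)

theorem constTerm_ofVir (w : Vir) : constTerm Φ hΦ hΦs (ofVir Φ hΦ hΦs w) = 0 :=
  (congrArg (TensorProduct.lid ℂ 𝔤)
    (map_zero (LinearMap.rTensor 𝔤 ((AddMonoidAlgebra.basis ℤ ℂ).coord 0)))).trans (map_zero _)

theorem degreeForm_virD_zero : degreeForm Φ hΦ hΦs (virD Φ hΦ hΦs 0) = 1 := by
  rw [virD, degreeForm_ofVir]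
  exact (Witt.basis.repr_self_apply 0 0).trans (if_pos rfl)

theorem degreeForm_virC : degreeForm Φ hΦ hΦs (virC Φ hΦ hΦs) = 0 := by
  rw [virC, degreeForm_ofVir]
  exact map_zero (Witt.basis.coord 0)

theorem constTerm_loopElt_zero (x : 𝔤) :
    constTerm Φ hΦ hΦs (loopElt Φ hΦ hΦs 0 x) = x := by
  have h : AddMonoidAlgebra.single (0 : ℤ) (1 : ℂ) = AddMonoidAlgebra.basis ℤ ℂ 0 := by simp
  rw [loopElt_apply, constTerm_ofAff_affLift, h, LinearMap.rTensor_tmul, TensorProduct.lid_tmul,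
    Module.Basis.coord_apply, Module.Basis.repr_self, Finsupp.single_eq_same, one_smul]

variable (Φ hΦ hΦs H) in
/-- The linear form `φ + n δ` on the Cartan subalgebra, for `φ` a linear form on `𝔤`. -/
def loopWeight (φ : Module.Dual ℂ 𝔤) (n : ℂ) : Module.Dual ℂ (cartan Φ hΦ hΦs H) :=
  (φ ∘ₗ constTerm Φ hΦ hΦs + n • degreeForm Φ hΦ hΦs) ∘ₗ (cartan Φ hΦ hΦs H).subtype

theorem loopWeight_apply (φ : Module.Dual ℂ 𝔤) (n : ℂ) (z : cartan Φ hΦ hΦs H) :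
    loopWeight Φ hΦ hΦs H φ n z = φ (constTerm Φ hΦ hΦs z) + n * degreeForm Φ hΦ hΦs z := rfl

theorem loopWeight_add (φ ψ : Module.Dual ℂ 𝔤) (n m : ℂ) :
    loopWeight Φ hΦ hΦs H φ n + loopWeight Φ hΦ hΦs H ψ m =
      loopWeight Φ hΦ hΦs H (φ + ψ) (n + m) := by
  ext z
  simp only [LinearMap.add_apply, loopWeight_apply]
  ring

theorem loopWeight_smul (c : ℂ) (φ : Module.Dual ℂ 𝔤) (n : ℂ) :
    c • loopWeight Φ hΦ hΦs H φ n = loopWeight Φ hΦ hΦs H (c • φ) (c * n) := by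
  ext z
  simp only [LinearMap.smul_apply, loopWeight_apply, smul_eq_mul]
  ring

theorem loopWeight_zero : loopWeight Φ hΦ hΦs H 0 0 = 0 := by
  ext z
  simp [loopWeight_apply]

theorem loopElt_zero_mem_cartan {x : 𝔤} (hx : x ∈ H) :
    loopElt Φ hΦ hΦs 0 x ∈ cartan Φ hΦ hΦs H :=
  Submodule.mem_sup_left (Submodule.mem_map_of_mem hx)

variable (hΦ hΦs) in
/-- The element `h ⊗ t^0` of the Cartan subalgebra. -/
def cartanElt {x : 𝔤} (hx : x ∈ H) : cartan Φ hΦ hΦs H :=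
  ⟨loopElt Φ hΦ hΦs 0 x, loopElt_zero_mem_cartan hx⟩

theorem loopWeight_cartanElt (φ : Module.Dual ℂ 𝔤) (n : ℂ) {x : 𝔤} (hx : x ∈ H) :
    loopWeight Φ hΦ hΦs H φ n (cartanElt hΦ hΦs hx) = φ x := by
  have h1 : degreeForm Φ hΦ hΦs (loopElt Φ hΦ hΦs 0 x) = 0 := degreeForm_ofAff _
  have h2 := constTerm_loopElt_zero (Φ := Φ) (hΦ := hΦ) (hΦs := hΦs) x
  simp only [loopWeight_apply, cartanElt, h1, h2, mul_zero, add_zero]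

theorem cartan_lie_loopElt {φ : Module.Dual ℂ 𝔤} {x : 𝔤} (hx : ∀ y ∈ H, ⁅y, x⁆ = φ y • x) (n : ℤ)
    (z : cartan Φ hΦ hΦs H) :
    ⁅(z : AffVir Φ hΦ hΦs), loopElt Φ hΦ hΦs n x⁆ =
      loopWeight Φ hΦ hΦs H φ n z • loopElt Φ hΦ hΦs n x := by
  obtain ⟨z, hz⟩ := z
  rw [loopWeight_apply]
  show ⁅z, _⁆ = (φ (constTerm Φ hΦ hΦs z) + n * degreeForm Φ hΦ hΦs z) • _
  obtain ⟨u, ⟨y, hy, rfl⟩, w, hw, rfl⟩ := Submodule.mem_sup.mp hz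
  have h1 : ⁅loopElt Φ hΦ hΦs 0 y, loopElt Φ hΦ hΦs n x⁆ = φ y • loopElt Φ hΦ hΦs n x := by
    rw [loopElt_lie_loopElt, hx y hy, zero_add, map_smul]
    -- The cocycle term is supported at `n = 0`, where its factor `n` vanishes.
    by_cases hn : n = 0 <;> simp [hn]
  have h2 : ⁅w, loopElt Φ hΦ hΦs n x⁆ =
      (φ (constTerm Φ hΦ hΦs w) + n * degreeForm Φ hΦ hΦs w) • loopElt Φ hΦ hΦs n x := by
    clear hz
    induction hw using Submodule.span_induction with
    | mem w hw =>
      rcases hw with rfl | rfl | rfl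
      · rw [affK_lie, constTerm_affK, affK, degreeForm_ofAff]; simp
      · rw [virD_lie_loopElt, degreeForm_virD_zero, virD, constTerm_ofVir]; simp
      · rw [virC_lie, degreeForm_virC, virC, constTerm_ofVir]; simp
    | zero => simp
    | add a b _ _ ha hb => rw [add_lie, ha, hb, ← add_smul]; simp only [map_add]; congr 1; ring
    | smul c a _ ha => rw [smul_lie, ha, smul_smul]; simp only [map_smul, smul_eq_mul]; congr 1; ring
  rw [add_lie, h1, h2, map_add, map_add, constTerm_loopElt_zero, map_add,
    loopElt_apply _ _ _ 0 y, degreeForm_ofAff, zero_add, ← add_smul, add_assoc]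

end Weights

end LoopAffVir
end

noncomputable section

namespace LoopAffVir

/-! ### Operators on modules, Weyl group translations and the Heisenberg argument. -/

section Modules

variable {𝔤 : Type*} [LieRing 𝔤] [LieAlgebra ℂ 𝔤] {Φ : LinearMap.BilinForm ℂ 𝔤}
  {hΦ : Φ.lieInvariant 𝔤} {hΦs : Φ.IsSymm} {H : LieSubalgebra ℂ 𝔤}
  {A : Type*} [CommRing A] [Algebra ℂ A] {V : Type*} [AddCommGroup V] [Module ℂ V]
  [LieRingModule (LoopAffVirAlg Φ hΦ hΦs A) V] [LieModule ℂ (LoopAffVirAlg Φ hΦ hΦs A) V]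

variable (Φ hΦ hΦs V) in
/-- The action of `(x ⊗ t^n) ⊗ a` on a module. -/
def loopOp (a : A) (n : ℤ) (x : 𝔤) : Module.End ℂ V :=
  LieModule.toEnd ℂ (LoopAffVirAlg Φ hΦ hΦs A) V (a ⊗ₜ loopElt Φ hΦ hΦs n x)

variable (Φ hΦ hΦs V) in
/-- The action of `K ⊗ a` on a module. -/
def cenOp (a : A) : Module.End ℂ V :=
  LieModule.toEnd ℂ (LoopAffVirAlg Φ hΦ hΦs A) V (a ⊗ₜ affK Φ hΦ hΦs)

theorem loopOp_apply (a : A) (n : ℤ) (x : 𝔤) (v : V) : loopOp Φ hΦ hΦs V a n x v =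
    ⁅(a ⊗ₜ loopElt Φ hΦ hΦs n x : LoopAffVirAlg Φ hΦ hΦs A), v⁆ := rfl

theorem cenOp_apply (a : A) (v : V) : cenOp Φ hΦ hΦs V a v =
    ⁅(a ⊗ₜ affK Φ hΦ hΦs : LoopAffVirAlg Φ hΦ hΦs A), v⁆ := rfl

theorem tmul_lie_tmul (a b : A) (X Y : AffVir Φ hΦ hΦs) :
    ⁅(a ⊗ₜ[ℂ] X : LoopAffVirAlg Φ hΦ hΦs A), (b ⊗ₜ[ℂ] Y : LoopAffVirAlg Φ hΦ hΦs A)⁆ =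
      (a * b) ⊗ₜ[ℂ] ⁅X, Y⁆ :=
  LieAlgebra.ExtendScalars.bracket_tmul ℂ A _ _ a b X Y

theorem loopOp_loopOp (a b : A) (n m : ℤ) (x y : 𝔤) (v : V) :
    loopOp Φ hΦ hΦs V a n x (loopOp Φ hΦ hΦs V b m y v) =
      loopOp Φ hΦ hΦs V b m y (loopOp Φ hΦ hΦs V a n x v) +
        (loopOp Φ hΦ hΦs V (a * b) (n + m) ⁅x, y⁆ v +
          (if m = -n then (m : ℂ) * Φ x y else 0) • cenOp Φ hΦ hΦs V (a * b) v) := by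
  simp only [loopOp_apply, cenOp_apply]
  rw [leibniz_lie, tmul_lie_tmul, loopElt_lie_loopElt, TensorProduct.tmul_add,
    TensorProduct.tmul_smul, add_lie, smul_lie, add_comm]

theorem affK_tmul_lie (a : A) (X : LoopAffVirAlg Φ hΦ hΦs A) :
    ⁅(a ⊗ₜ affK Φ hΦ hΦs : LoopAffVirAlg Φ hΦ hΦs A), X⁆ = 0 := by
  induction X using TensorProduct.induction_on with
  | zero => rw [lie_zero]
  | tmul b Y => rw [tmul_lie_tmul, affK_lie, TensorProduct.tmul_zero]
  | add X Y hX hY => rw [lie_add, hX, hY, add_zero]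

theorem cenOp_lie (a : A) (X : LoopAffVirAlg Φ hΦ hΦs A) (v : V) :
    cenOp Φ hΦ hΦs V a ⁅X, v⁆ = ⁅X, cenOp Φ hΦ hΦs V a v⁆ := by
  rw [cenOp_apply, cenOp_apply, leibniz_lie, affK_tmul_lie, zero_lie, zero_add]

/-- Schur's lemma: `K ⊗ a` acts by a scalar. -/
theorem exists_cenOp_eq_smul (hirr : LieModule.IsIrreducible ℂ (LoopAffVirAlg Φ hΦ hΦs A) V)
    {μ : Module.Dual ℂ (cartan Φ hΦ hΦs H)} (hμ : weightSpace Φ hΦ hΦs A H V μ ≠ ⊥)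
    [FiniteDimensional ℂ (weightSpace Φ hΦ hΦs A H V μ)] (a : A) :
    ∃ c : ℂ, ∀ v : V, cenOp Φ hΦ hΦs V a v = c • v := by
  have : Nontrivial (weightSpace Φ hΦ hΦs A H V μ) := Submodule.nontrivial_iff_ne_bot.mpr hμ
  obtain ⟨c, hc⟩ := Module.End.exists_eigenvalue ((cenOp Φ hΦ hΦs V a).restrict
    (p := weightSpace Φ hΦ hΦs A H V μ) (fun v hv z => by rw [← cenOp_lie, hv z, map_smul]))
  obtain ⟨w, hw, hw0⟩ := hc.exists_hasEigenvector
  have hw' : cenOp Φ hΦ hΦs V a w = c • (w : V) :=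
    congrArg Subtype.val (Module.End.mem_eigenspace_iff.mp hw)
  -- Since `K ⊗ a` is central, its eigenspace is a submodule, and it is nonzero.
  let N : LieSubmodule ℂ (LoopAffVirAlg Φ hΦ hΦs A) V :=
    { Module.End.eigenspace (cenOp Φ hΦ hΦs V a) c with
      lie_mem := fun {X v} hv => by
        have hv : cenOp Φ hΦ hΦs V a v = c • v := Module.End.mem_eigenspace_iff.mp hv
        exact Module.End.mem_eigenspace_iff.mpr (by rw [cenOp_lie, hv, lie_smul]) }
  have hN : N = ⊤ := (hirr.eq_bot_or_eq_top N).resolve_left fun h => by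
    have : (w : V) ∈ N := Module.End.mem_eigenspace_iff.mpr hw'
    rw [h, LieSubmodule.mem_bot] at this
    exact hw0 (by simpa using this)
  refine ⟨c, fun v => Module.End.mem_eigenspace_iff.mp (?_ : v ∈ N)⟩
  rw [hN]
  exact LieSubmodule.mem_top v

theorem loopOp_mem_weightSpace {φ : Module.Dual ℂ 𝔤} {x : 𝔤} (hx : ∀ y ∈ H, ⁅y, x⁆ = φ y • x)
    (a : A) (n : ℤ) {μ : Module.Dual ℂ (cartan Φ hΦ hΦs H)} {v : V}
    (hv : v ∈ weightSpace Φ hΦ hΦs A H V μ) :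
    loopOp Φ hΦ hΦs V a n x v ∈
      weightSpace Φ hΦ hΦs A H V (μ + loopWeight Φ hΦ hΦs H φ n) := by
  intro z
  rw [loopOp_apply, leibniz_lie, tmul_lie_tmul, one_mul, cartan_lie_loopElt hx, hv z,
    TensorProduct.tmul_smul, smul_lie, lie_smul, ← add_smul, LinearMap.add_apply, add_comm (μ z)]

theorem loopOp_pow_mem_weightSpace {φ : Module.Dual ℂ 𝔤} {x : 𝔤}
    (hx : ∀ y ∈ H, ⁅y, x⁆ = φ y • x) (a : A) (n : ℤ) {μ : Module.Dual ℂ (cartan Φ hΦ hΦs H)}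
    {v : V} (hv : v ∈ weightSpace Φ hΦ hΦs A H V μ) (k : ℕ) :
    (loopOp Φ hΦ hΦs V a n x ^ k) v ∈
      weightSpace Φ hΦ hΦs A H V (μ + (k : ℂ) • loopWeight Φ hΦ hΦs H φ n) := by
  induction k with
  | zero => simpa using hv
  | succ k ih =>
    rw [pow_succ', Module.End.mul_apply]
    convert loopOp_mem_weightSpace hx a n ih using 2
    push_cast
    module

theorem loopOp_zero_apply_of_mem {x : 𝔤} (hx : x ∈ H) {μ : Module.Dual ℂ (cartan Φ hΦ hΦs H)}
    {v : V} (hv : v ∈ weightSpace Φ hΦ hΦs A H V μ) :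
    loopOp Φ hΦ hΦs V (1 : A) 0 x v = μ (cartanElt hΦ hΦs hx) • v :=
  hv (cartanElt hΦ hΦs hx)

variable {φ : Module.Dual ℂ 𝔤} {e f h : 𝔤}

/-- At level zero, the real roots `±(φ + n δ)` give `sl₂`-triples of operators. -/
theorem isSl2Action_loopOp (t : IsRootTriple H Φ φ e f h)
    (hK : ∀ v, cenOp Φ hΦ hΦs V (1 : A) v = 0) (n : ℤ) :
    IsSl2Action (loopOp Φ hΦ hΦs V (1 : A) n e) (loopOp Φ hΦ hΦs V (1 : A) (-n) f)
      (loopOp Φ hΦ hΦs V (1 : A) 0 h) where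
  ef v := by
    rw [loopOp_loopOp, mul_one, hK, smul_zero, add_zero, add_neg_cancel, t.lie_e_f]
  he v := by
    rw [loopOp_loopOp, mul_one, hK, smul_zero, add_zero, zero_add, t.lie_e h t.h_mem, t.apply_h]
    simp only [loopOp_apply, map_smul, TensorProduct.tmul_smul, smul_lie]
  hf v := by
    rw [loopOp_loopOp, mul_one, hK, smul_zero, add_zero, zero_add, t.lie_f h t.h_mem,
      LinearMap.neg_apply, t.apply_h]
    simp only [loopOp_apply, ← neg_smul, map_smul, TensorProduct.tmul_smul, smul_lie,
      sub_eq_add_neg]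

/-- The target weight is the reflection of `μ` in the real root `φ + nδ`, and `(f ⊗ t^{-n})^m` maps
into it injectively by `eq_zero_of_pow_f`. -/
theorem finrank_weightSpace_le (t : IsRootTriple H Φ φ e f h)
    (hK : ∀ v, cenOp Φ hΦ hΦs V (1 : A) v = 0)
    (hfin : ∀ μ, FiniteDimensional ℂ (weightSpace Φ hΦ hΦs A H V μ))
    (hnil : ∀ n v, ∃ N : ℕ, (loopOp Φ hΦ hΦs V (1 : A) n e ^ N) v = 0)
    {μ : Module.Dual ℂ (cartan Φ hΦ hΦs H)} {m : ℕ} (hμ : μ (cartanElt hΦ hΦs t.h_mem) = m)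
    (n : ℤ) : Module.finrank ℂ (weightSpace Φ hΦ hΦs A H V μ) ≤
      Module.finrank ℂ (weightSpace Φ hΦ hΦs A H V
        (μ + (m : ℂ) • loopWeight Φ hΦ hΦs H (-φ) (-n : ℤ))) := by
  have := hfin (μ + (m : ℂ) • loopWeight Φ hΦ hΦs H (-φ) (-n : ℤ))
  refine LinearMap.finrank_le_finrank_of_injective
    (f := (loopOp Φ hΦ hΦs V (1 : A) (-n) f ^ m).restrict
      fun v hv => loopOp_pow_mem_weightSpace t.lie_f 1 (-n) hv m) ?_
  rw [← LinearMap.ker_eq_bot, LinearMap.ker_eq_bot']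
  intro v hv
  obtain ⟨N, hN⟩ := hnil n v
  refine Subtype.ext ((isSl2Action_loopOp t hK n).eq_zero_of_pow_f m N ?_ hN
    (congrArg Subtype.val hv))
  rw [loopOp_zero_apply_of_mem t.h_mem v.2, hμ]

/-- Translations by the affine Weyl group preserve dimensions of weight spaces. -/
theorem finrank_weightSpace_translate_le (t : IsRootTriple H Φ φ e f h)
    (hK : ∀ v, cenOp Φ hΦ hΦs V (1 : A) v = 0)
    (hfin : ∀ μ, FiniteDimensional ℂ (weightSpace Φ hΦ hΦs A H V μ))
    (he : ∀ n v, ∃ N : ℕ, (loopOp Φ hΦ hΦs V (1 : A) n e ^ N) v = 0)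
    (hf : ∀ n v, ∃ N : ℕ, (loopOp Φ hΦ hΦs V (1 : A) n f ^ N) v = 0)
    {μ : Module.Dual ℂ (cartan Φ hΦ hΦs H)} {m : ℕ} (hμ : μ (cartanElt hΦ hΦs t.h_mem) = m)
    (q : ℤ) : Module.finrank ℂ (weightSpace Φ hΦ hΦs A H V
        (μ + loopWeight Φ hΦ hΦs H 0 ((m * q : ℤ) : ℂ))) ≤
      Module.finrank ℂ (weightSpace Φ hΦ hΦs A H V μ) := by
  set ν := μ + loopWeight Φ hΦ hΦs H 0 ((m * q : ℤ) : ℂ) with hν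
  have h1 : ν (cartanElt hΦ hΦs t.h_mem) = m := by
    rw [hν, LinearMap.add_apply, loopWeight_cartanElt, hμ, LinearMap.zero_apply, add_zero]
  -- Reflecting `ν` in `φ` gives `ν - mφ`, with value `-m` on `h`. Reflecting that in `-φ + qδ` adds
  -- `m(φ - qδ)` and lands on `ν - mqδ = μ`.
  have h2 := finrank_weightSpace_le t hK hfin he h1 0
  have ts := t.symm hΦs
  have h3 : (ν + (m : ℂ) • loopWeight Φ hΦ hΦs H (-φ) (-0 : ℤ))
      (cartanElt hΦ hΦs ts.h_mem) = m := by
    have h4 : cartanElt hΦ hΦs ts.h_mem = -cartanElt hΦ hΦs t.h_mem :=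
      Subtype.ext (map_neg (loopElt Φ hΦ hΦs 0) h)
    rw [h4, map_neg, LinearMap.add_apply, h1, LinearMap.smul_apply, loopWeight_cartanElt,
      LinearMap.neg_apply, t.apply_h, smul_eq_mul]
    ring
  have h4 := finrank_weightSpace_le ts hK hfin hf h3 q
  have h5 : ν + (m : ℂ) • loopWeight Φ hΦ hΦs H (-φ) (-0 : ℤ) +
      (m : ℂ) • loopWeight Φ hΦ hΦs H (- -φ) (-q : ℤ) = μ := by
    rw [hν, add_assoc, add_assoc, loopWeight_smul, loopWeight_smul, loopWeight_add, loopWeight_add]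
    convert add_zero μ using 2
    convert loopWeight_zero using 2
    · module
    · push_cast; ring
  rw [h5] at h4
  exact h2.trans h4

/-- If `K ⊗ a` acts by a nonzero scalar, no weight takes a positive value on the coroot. -/
theorem weightSpace_eq_bot_of_pos (t : IsRootTriple H Φ φ e f h)
    (hK : ∀ v, cenOp Φ hΦ hΦs V (1 : A) v = 0)
    (hfin : ∀ μ, FiniteDimensional ℂ (weightSpace Φ hΦ hΦs A H V μ))
    (he : ∀ n v, ∃ N : ℕ, (loopOp Φ hΦ hΦs V (1 : A) n e ^ N) v = 0)
    (hf : ∀ n v, ∃ N : ℕ, (loopOp Φ hΦ hΦs V (1 : A) n f ^ N) v = 0)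
    {a : A} {c : ℂ} (hc0 : c ≠ 0) (hc : ∀ v, cenOp Φ hΦ hΦs V a v = c • v)
    {μ : Module.Dual ℂ (cartan Φ hΦ hΦs H)} {m : ℕ} (hm : m ≠ 0)
    (hμ : μ (cartanElt hΦ hΦs t.h_mem) = m) : weightSpace Φ hΦ hΦs A H V μ = ⊥ := by
  by_contra hne
  have hh : ∀ y ∈ H, ⁅y, h⁆ = (0 : Module.Dual ℂ 𝔤) y • h := fun y hy => by
    rw [t.lie_h y hy, LinearMap.zero_apply, zero_smul]
  have h0 : ∀ (b : A) (n : ℤ) (v : V), loopOp Φ hΦ hΦs V b n 0 v = 0 := fun b n v => by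
    rw [loopOp_apply, map_zero, TensorProduct.tmul_zero, zero_lie]
  have hcomm : ∀ (b b' : A) (i j : ℤ), j ≠ -i →
      Commute (loopOp Φ hΦ hΦs V b i h) (loopOp Φ hΦ hΦs V b' j h) := fun b b' i j hij =>
    LinearMap.ext fun v => by
      rw [Module.End.mul_apply, loopOp_loopOp, lie_self, h0, if_neg hij]
      simp
  have hshift : ∀ (b : A) (n k : ℤ) (v : V),
      v ∈ weightSpace Φ hΦ hΦs A H V (μ + loopWeight Φ hΦ hΦs H 0 (k : ℂ)) →
      loopOp Φ hΦ hΦs V b n h v ∈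
        weightSpace Φ hΦ hΦs A H V (μ + loopWeight Φ hΦ hΦs H 0 ((k + n : ℤ) : ℂ)) := by
    intro b n k v hv
    have := loopOp_mem_weightSpace hh b n hv
    rwa [add_assoc, loopWeight_add, add_zero, ← Int.cast_add] at this
  -- Putting `a` on the positive modes and `1` on the negative ones makes the central term of the
  -- commutator `-n Φ(h, h) K ⊗ a`. The grading is by `V_{μ + kδ}`, and the bound `d` is `dim V_μ`.
  refine weyl_dim_unbounded (fun n => loopOp Φ hΦ hΦs V a n h)
    (fun n => loopOp Φ hΦ hΦs V (1 : A) (-n) h) (fun n => -n * Φ h h * c)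
    (fun i hi => mul_ne_zero (mul_ne_zero (neg_ne_zero.mpr (Nat.cast_ne_zero.mpr hi.ne'))
      (t.form_h_ne_zero hΦ hΦs)) hc0)
    (fun i j hi hj => hcomm _ _ _ _ (by omega)) (fun i j hi hj => hcomm _ _ _ _ (by omega))
    (fun i j hi hj v => ?_)
    (fun k => weightSpace Φ hΦ hΦs A H V (μ + loopWeight Φ hΦ hΦs H 0 (k : ℂ)))
    (fun i k v hv => hshift _ _ _ _ hv) (fun i k v hv => hshift _ _ _ _ hv) ?_
    (fun k => hfin _) m hm _ (fun q => finrank_weightSpace_translate_le t hK hfin he hf hμ q)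
  · rw [loopOp_loopOp, lie_self, h0, zero_add, mul_one, hc]
    by_cases hij : i = j
    · subst hij
      simp [smul_smul]
    · rw [if_neg (by omega), if_neg hij, zero_smul, zero_smul]
  · rwa [Int.cast_zero, loopWeight_zero, add_zero]

end Modules

end LoopAffVir
end

/-! ### The main theorem. -/

open LoopAffVir in
theorem mainTheorem7
    {𝔤 : Type*} [LieRing 𝔤] [LieAlgebra ℂ 𝔤] [FiniteDimensional ℂ 𝔤] [LieAlgebra.IsSimple ℂ 𝔤]
    (H : LieSubalgebra ℂ 𝔤) [H.IsCartanSubalgebra]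
    (Φ : LinearMap.BilinForm ℂ 𝔤) (hΦ : Φ.lieInvariant 𝔤) (hΦs : Φ.IsSymm) (hΦn : Φ.Nondegenerate)
    (A : Type*) [CommRing A] [Algebra ℂ A] [Algebra.FiniteType ℂ A]
    (V : Type*) [AddCommGroup V] [Module ℂ V]
    [LieRingModule (LoopAffVir.LoopAffVirAlg Φ hΦ hΦs A) V]
    [LieModule ℂ (LoopAffVir.LoopAffVirAlg Φ hΦ hΦs A) V]
    (hirr : LieModule.IsIrreducible ℂ (LoopAffVir.LoopAffVirAlg Φ hΦ hΦs A) V)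
    (hint : LoopAffVir.IsIntegrable Φ hΦ hΦs A H V)
    (hK : ∀ v : V,
      ⁅((1 : A) ⊗ₜ[ℂ] LoopAffVir.affK Φ hΦ hΦs : LoopAffVir.LoopAffVirAlg Φ hΦ hΦs A), v⁆ = 0) :
    ∀ (a : A) (v : V),
      ⁅(a ⊗ₜ[ℂ] LoopAffVir.affK Φ hΦ hΦs : LoopAffVir.LoopAffVirAlg Φ hΦ hΦs A), v⁆ = 0 := by
  intro a
  change ∀ v, cenOp Φ hΦ hΦs V (1 : A) v = 0 at hK
  change ∀ v, cenOp Φ hΦ hΦs V a v = 0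
  obtain ⟨hdirect, hfin, hnil⟩ := hint
  have htop : ⨆ μ, weightSpace Φ hΦ hΦs A H V μ = ⊤ := by
    classical exact hdirect.submodule_iSup_eq_top
  have : Nontrivial 𝔤 := LieModule.nontrivial_of_isIrreducible ℂ 𝔤 𝔤
  obtain ⟨α, φ, e, f, h, hα, heα, hfα, t⟩ := exists_isRootTriple (H := H) hΦ hΦn
  have he : ∀ n v, ∃ N : ℕ, (loopOp Φ hΦ hΦs V (1 : A) n e ^ N) v = 0 := fun n v =>
    hnil α hα e heα n 1 v
  have hf : ∀ n v, ∃ N : ℕ, (loopOp Φ hΦ hΦs V (1 : A) n f ^ N) v = 0 := fun n v =>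
    hnil (-α) hα.neg f hfα n 1 v
  obtain ⟨μ₀, hμ₀⟩ : ∃ μ, weightSpace Φ hΦ hΦs A H V μ ≠ ⊥ := by
    by_contra! hcon
    have : Nontrivial V := LieModule.nontrivial_of_isIrreducible ℂ (LoopAffVirAlg Φ hΦ hΦs A) V
    rw [iSup_congr hcon, iSup_bot] at htop
    exact bot_ne_top htop
  have := hfin μ₀
  obtain ⟨c, hc⟩ := exists_cenOp_eq_smul hirr hμ₀ a
  obtain rfl | hc0 := eq_or_ne c 0
  · simpa using hc
  -- every weight vanishes on the coroot
  have hzero : ∀ μ, weightSpace Φ hΦ hΦs A H V μ ≠ ⊥ → μ (cartanElt hΦ hΦs t.h_mem) = 0 := by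
    intro μ hμ
    obtain ⟨v, hv, hv0⟩ := Submodule.exists_mem_ne_zero_of_ne_bot hμ
    obtain ⟨m, hm⟩ := (isSl2Action_loopOp t hK 0).exists_int
      (loopOp_zero_apply_of_mem t.h_mem hv) hv0 (he 0) (hf (-0))
    rw [hm]
    rcases lt_trichotomy m 0 with hneg | rfl | hpos
    · obtain ⟨k, hk⟩ : ∃ k : ℕ, m = -k := ⟨m.natAbs, by omega⟩
      have ts := t.symm hΦs
      refine absurd (weightSpace_eq_bot_of_pos ts hK hfin hf he hc0 hc (m := k) (by omega) ?_) hμ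
      have h4 : cartanElt hΦ hΦs ts.h_mem = -cartanElt hΦ hΦs t.h_mem :=
        Subtype.ext (map_neg (loopElt Φ hΦ hΦs 0) h)
      rw [h4, map_neg, hm, hk]
      simp
    · simp
    · obtain ⟨k, hk⟩ : ∃ k : ℕ, m = k := ⟨m.natAbs, by omega⟩
      refine absurd (weightSpace_eq_bot_of_pos t hK hfin he hf hc0 hc (m := k) (by omega) ?_) hμ
      rw [hm, hk]
      simp
  -- A nonzero image of a weight vector would have a weight with value `0 + φ(h) = 2` on the coroot.
  have hact : ∀ (b : A) (n : ℤ) (v : V), loopOp Φ hΦ hΦs V b n e v = 0 := by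
    intro b n v
    suffices hle : (⊤ : Submodule ℂ V) ≤ LinearMap.ker (loopOp Φ hΦ hΦs V b n e) from
      hle Submodule.mem_top
    rw [← htop]
    refine iSup_le fun μ v hv => ?_
    rw [LinearMap.mem_ker]
    by_contra hne
    have hmem := loopOp_mem_weightSpace t.lie_e b n hv
    have h1 := hzero μ ((Submodule.ne_bot_iff _).mpr ⟨v, hv, fun h0 => hne (by rw [h0, map_zero])⟩)
    have h2 := hzero _ ((Submodule.ne_bot_iff _).mpr ⟨_, hmem, hne⟩)
    rw [LinearMap.add_apply, h1, loopWeight_cartanElt, t.apply_h, zero_add] at h2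
    exact two_ne_zero h2
  intro v
  -- Both commutators act by zero. The first equals `h ⊗ a`, the second `h ⊗ a + Φ(e, f) K ⊗ a`.
  have h0 := loopOp_loopOp (Φ := Φ) (hΦ := hΦ) (hΦs := hΦs) a 1 0 0 e f v
  have h1 := loopOp_loopOp (Φ := Φ) (hΦ := hΦ) (hΦs := hΦs) a 1 (-1) 1 e f v
  rw [hact, hact, map_zero, zero_add, if_pos (by norm_num)] at h0
  rw [hact, hact, map_zero, zero_add, if_pos (by norm_num)] at h1
  rw [mul_one] at h0 h1
  rw [Int.cast_zero, zero_mul, zero_smul, add_zero, add_zero] at h0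
  rw [neg_add_cancel, ← h0, zero_add, Int.cast_one, one_mul, eq_comm, smul_eq_zero] at h1
  exact h1.resolve_left t.form_ne_zero
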